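/- **Gram–Schmidt for $\mathrm W^*$-categories.** A $\mathrm W^*$-category is a $\mathbb C$-linear category with set-sized hom-spaces and an antilinear involution $*:\mathrm{Hom}(X,Y)\to\mathrm{Hom}(Y,X)$, $f^{**}=f$, $(fg)^*=g^*f^*$, such that $\mathrm{End}(X)$ is ($*$-isomorphic to) a von Neumann algebra for every formal finite direct sum $X$ of objects; functors between $\mathrm W^*$-categories are linear $*$-functors that are normal on all these endomorphism algebras. An orthogonal direct sum of objects $c_j$ is an object $x$ with morphisms $\iota_j:c_j\to x$ such that $\iota_j^*\iota_k=\delta_{jk}\,\mathrm{id}$ and $\sum_j\iota_j\iota_j^*=\mathrm{id}_x$ (supremum of the finite partial sums). $C$ is Cauchy complete if every set-indexed family of objects has an orthogonal direct sum and every $p=p^2=p^*$ is of the form $\iota\iota^*$ with $\iota^*\iota=\mathrm{id}$. A set of objects generates a $\mathrm W^*$-category if every non-zero object of its idempotent completion (by self-adjoint idempotents) receives a non-zero morphism from a member of the set. In a Cauchy complete $C$, the full subcategory generated by an object $c$ consists of the objects isomorphic to an orthogonal direct sum of objects that split projections in $\mathrm{End}(c)$; the one generated by a family is the one generated by its orthogonal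 direct sum. For $\mathrm W^*$-categories $D_k$, $\boxplus_k D_k$ has as objects the families $(x_k)$, $x_k\in D_k$, and as morphisms the norm-bounded families; a category $E$ is the orthogonal direct sum $\boxplus_k D_k$ of full subcategories $D_k$ if there is an equivalence of $\mathrm W^*$-categories $E\simeq\boxplus_k D_k$, $x\mapsto (x_k)$, together with morphisms $x_k\to x$, natural in $x$, that exhibit $x$ as the orthogonal direct sum of the $x_k$. The functors $x\mapsto x_k$ are the orthogonal projections $E\twoheadrightarrow D_k$. Let $C$ be a Cauchy complete $\mathrm W^*$-category, and let $\{c_i\}_{i\in I}$ be a set of generators of $C$ indexed by a well-ordered set $I$. For $i\in I$ let $C_{<i}$ and $C_{\le i}$ be the full subcategories generated by $\{c_j\}_{j<i}$ and by $\{c_j\}_{j\le i}$, and let $$C_i:=\{x\in C_{\le i}\mid \mathrm{Hom}(d,x)=0\ \text{ for all } d\in C_{<i}\}$$ be the orthogonal complement of $C_{<i}$ inside $C_{\le i}$. Then: 1. $C_{\le i}=C_{<i}\boxplus C_i$ for every $i$; let $P_i:C_{\le i}\twoheadrightarrow C_{<i}$ and $Q_i:C_{\le i}\twoheadrightarrow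 C_i$ be the orthogonal projections (for any choice of this decomposition). 2. $C=\boxplus_{i\in I}C_i$; the projections $C\twoheadrightarrow C_i$ of any such decomposition, restricted to $C_{\le i}$, agree with $Q_i$ up to unitary isomorphism compatible with the inclusions into the given object. 3. For every $i$, the object $Q_i(c_i)$ generates $C_i$. 4. $\{Q_i(c_i)\}_{i\in I}$ is an orthogonal set of generators for $C$: it generates $C$, and $\mathrm{Hom}(Q_i(c_i),Q_j(c_j))=0$ for $i\neq j$. -/

import Mathlib

open CategoryTheory

universe w v u u'

set_option linter.unusedSectionVars false

namespace WStarCat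

noncomputable section

/-! ## `*`-categories -/

/-- A `*`-category: a `ℂ`-linear category with an antilinear, involutive, contravariant operation
`dag : Hom(X, Y) → Hom(Y, X)` which is the identity on objects. -/
class StarCategory (C : Type u) [Category.{v} C] [Preadditive C] [Linear ℂ C] where
  dag : ∀ {X Y : C}, (X ⟶ Y) → (Y ⟶ X)
  dag_dag : ∀ {X Y : C} (f : X ⟶ Y), dag (dag f) = f
  dag_comp : ∀ {X Y Z : C} (f : X ⟶ Y) (g : Y ⟶ Z), dag (f ≫ g) = dag g ≫ dag f
  dag_add : ∀ {X Y : C} (f g : X ⟶ Y), dag (f + g) = dag f + dag g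
  dag_smul : ∀ {X Y : C} (z : ℂ) (f : X ⟶ Y), dag (z • f) = (starRingEnd ℂ z) • dag f

open StarCategory

attribute [simp] StarCategory.dag_dag StarCategory.dag_comp StarCategory.dag_add
  StarCategory.dag_smul

section Star

variable {C : Type u} [Category.{v} C] [Preadditive C] [Linear ℂ C] [StarCategory C]

@[simp] theorem dag_zero (X Y : C) : dag (0 : X ⟶ Y) = 0 := by
  have h := dag_add (0 : X ⟶ Y) 0
  rw [add_zero] at h
  exact left_eq_add.mp h

@[simp] theorem dag_id (X : C) : dag (𝟙 X) = 𝟙 X := by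
  have h := dag_comp (dag (𝟙 X)) (𝟙 X)
  rw [Category.comp_id, dag_dag, Category.comp_id] at h
  exact h.symm

theorem dag_sum {X Y : C} {ι : Type*} (s : Finset ι) (f : ι → (X ⟶ Y)) :
    dag (∑ i ∈ s, f i) = ∑ i ∈ s, dag (f i) :=
  map_sum (AddMonoidHom.mk' (fun g : X ⟶ Y => dag g) (fun a b => dag_add a b)) f s

theorem dag_eqToHom {X Y : C} (h : X = Y) : dag (eqToHom h) = eqToHom h.symm := by
  subst h; simp

/-- The endomorphism algebra of an object of a `*`-category is a unital `*`-algebra over `ℂ`. -/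
instance endStarRing (X : C) : StarRing (End X) where
  star f := dag (X := X) (Y := X) f
  star_involutive f := dag_dag (X := X) (Y := X) f
  star_mul f g := dag_comp (X := X) (Y := X) (Z := X) g f
  star_add f g := dag_add (X := X) (Y := X) f g

theorem end_star_def {X : C} (f : End X) : star f = dag (X := X) (Y := X) f := rfl

end Star

/-! ## The finite direct sum completion `C^⊕`

Mathlib's `Mat_ C` is the category of formal finite sums of objects of `C`, with matrices of
morphisms of `C` as morphisms. It is again a `*`-category. -/

section Mat

variable {C : Type u} [Category.{v} C] [Preadditive C] [Linear ℂ C]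

instance matLinear : Linear ℂ (Mat_ C) where
  homModule M N := inferInstanceAs (Module ℂ (∀ (i : M.ι) (j : N.ι), M.X i ⟶ N.X j))
  smul_comp X Y Z r f g := by
    ext i k
    change ∑ j, (r • f i j) ≫ g j k = r • ∑ j, f i j ≫ g j k
    simp [Finset.smul_sum]
  comp_smul X Y Z f r g := by
    ext i k
    change ∑ j, f i j ≫ (r • g j k) = r • ∑ j, f i j ≫ g j k
    simp [Finset.smul_sum]

theorem mat_smul_apply {M N : Mat_ C} (r : ℂ) (f : M ⟶ N) (i : M.ι) (j : N.ι) :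
    (r • f) i j = r • f i j := rfl

instance matStar [StarCategory C] : StarCategory (Mat_ C) where
  dag {M N} f := fun j i => dag (f i j)
  dag_dag {M N} f := by ext i j; exact dag_dag _
  dag_comp {M N K} f g := by
    ext i j
    change dag (∑ l, f j l ≫ g l i) = ∑ l, dag (g l i) ≫ dag (f j l)
    simp [dag_sum]
  dag_add {M N} f g := by ext i j; exact dag_add _ _
  dag_smul {M N} z f := by ext i j; exact dag_smul _ _

theorem mat_dag_apply [StarCategory C] {M N : Mat_ C} (f : M ⟶ N) (i : M.ι) (j : N.ι) :
    (dag f) j i = dag (f i j) := rfl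

open scoped Classical in
/-- The matrix whose only nonzero entry is `f`, in position `(i, j)`. -/
def single {Z : Mat_ C} (i j : Z.ι) (f : Z.X i ⟶ Z.X j) : Z ⟶ Z := fun a b =>
  if h : a = i ∧ b = j then
    eqToHom (congrArg Z.X h.1) ≫ f ≫ eqToHom (congrArg Z.X h.2.symm) else 0

theorem single_self {Z : Mat_ C} (i j : Z.ι) (f : Z.X i ⟶ Z.X j) : single i j f i j = f := by
  simp [single]

theorem single_of_ne {Z : Mat_ C} {i j a b : Z.ι} (f : Z.X i ⟶ Z.X j) (h : ¬ (a = i ∧ b = j)) :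
    single i j f a b = 0 := by
  simp [single, h]

theorem single_comp {Z : Mat_ C} (i j k : Z.ι) (f : Z.X i ⟶ Z.X j) (g : Z.X j ⟶ Z.X k) :
    single i j f ≫ single j k g = single i k (f ≫ g) := by
  ext a b
  rw [Mat_.comp_apply, Finset.sum_eq_single j]
  · by_cases ha : a = i
    · by_cases hb : b = k
      · subst ha hb; simp [single_self]
      · rw [single_of_ne g (by tauto), single_of_ne (f ≫ g) (by tauto), Limits.comp_zero]
    · rw [single_of_ne f (by tauto), single_of_ne (f ≫ g) (by tauto), Limits.zero_comp]
  · intro l _ hl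
    rw [single_of_ne f (by tauto), Limits.zero_comp]
  · simp

theorem single_add {Z : Mat_ C} (i j : Z.ι) (f g : Z.X i ⟶ Z.X j) :
    single i j (f + g) = single i j f + single i j g := by
  ext a b
  rw [Mat_.add_apply]
  by_cases h : a = i ∧ b = j
  · obtain ⟨rfl, rfl⟩ := h; simp [single_self]
  · simp [single_of_ne _ h]

theorem single_smul {Z : Mat_ C} (i j : Z.ι) (r : ℂ) (f : Z.X i ⟶ Z.X j) :
    single i j (r • f) = r • single i j f := by
  ext a b
  rw [mat_smul_apply]
  by_cases h : a = i ∧ b = j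
  · obtain ⟨rfl, rfl⟩ := h; simp [single_self]
  · simp [single_of_ne _ h]

theorem dag_single [StarCategory C] {Z : Mat_ C} (i j : Z.ι) (f : Z.X i ⟶ Z.X j) :
    dag (single i j f) = single j i (dag f) := by
  ext a b
  rw [mat_dag_apply]
  by_cases h : b = i ∧ a = j
  · obtain ⟨rfl, rfl⟩ := h; simp [single_self]
  · rw [single_of_ne _ h, single_of_ne _ (by tauto), dag_zero]

end Mat

/-! ## `W*`-algebras -/

/-- A realisation of a `*`-algebra as a von Neumann algebra on some Hilbert space. -/
structure WStarRep (A : Type v) [Ring A] [Algebra ℂ A] [StarRing A] where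
  H : Type v
  [normed : NormedAddCommGroup H]
  [inner : InnerProductSpace ℂ H]
  [complete : CompleteSpace H]
  S : VonNeumannAlgebra H
  iso : A ≃⋆ₐ[ℂ] S.toStarSubalgebra

attribute [instance] WStarRep.normed WStarRep.inner WStarRep.complete

/-- A `W*`-algebra is a `*`-algebra isomorphic to a von Neumann algebra on some Hilbert space. -/
def IsWStarAlgebra (A : Type v) [Ring A] [Algebra ℂ A] [StarRing A] : Prop :=
  Nonempty (WStarRep A)

namespace WStarRep

variable {A B : Type v} [Ring A] [Algebra ℂ A] [StarRing A] [Ring B] [Algebra ℂ B] [StarRing B]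

/-- The operator norm of an element in a given realisation. -/
def norm (r : WStarRep A) (a : A) : ℝ := ‖(r.iso a : r.H →L[ℂ] r.H)‖

theorem isClosed_carrier (r : WStarRep A) :
    IsClosed (r.S.toStarSubalgebra : Set (r.H →L[ℂ] r.H)) := by
  rw [VonNeumannAlgebra.coe_toStarSubalgebra, ← VonNeumannAlgebra.centralizer_centralizer]
  exact Set.isClosed_centralizer _

/-- Injective `*`-homomorphisms are isometric. -/
theorem norm_map (r : WStarRep A) (s : WStarRep B) (φ : A →⋆ₙₐ[ℂ] B)
    (hφ : Function.Injective φ) (a : A) : s.norm (φ a) = r.norm a := by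
  have : IsClosed (r.S.toStarSubalgebra : Set (r.H →L[ℂ] r.H)) := r.isClosed_carrier
  let e : r.S.toStarSubalgebra →⋆ₙₐ[ℂ] A :=
    { toFun := r.iso.symm
      map_smul' := fun z x => map_smul r.iso.symm z x
      map_zero' := map_zero _
      map_add' := map_add _
      map_mul' := map_mul _
      map_star' := map_star _ }
  let g : B →⋆ₙₐ[ℂ] (s.H →L[ℂ] s.H) :=
    { toFun := fun b => (s.iso b : s.H →L[ℂ] s.H)
      map_smul' := fun z x => by simp [map_smul s.iso z x]
      map_zero' := by simp
      map_add' := by simp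
      map_mul' := by simp
      map_star' := by simp [map_star] }
  let ψ : r.S.toStarSubalgebra →⋆ₙₐ[ℂ] (s.H →L[ℂ] s.H) := (g.comp φ).comp e
  have hψ : Function.Injective ψ := by
    intro x y hxy
    have h1 : s.iso (φ (r.iso.symm x)) = s.iso (φ (r.iso.symm y)) := Subtype.ext hxy
    exact r.iso.symm.injective (hφ (s.iso.injective h1))
  have h := NonUnitalStarAlgHom.norm_map ψ hψ (r.iso a)
  have h2 : ψ (r.iso a) = (s.iso (φ a) : s.H →L[ℂ] s.H) := by
    change (s.iso (φ (r.iso.symm (r.iso a))) : s.H →L[ℂ] s.H) = _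
    rw [StarAlgEquiv.symm_apply_apply]
  rw [h2] at h
  exact h

theorem norm_mul_le (r : WStarRep A) (a b : A) : r.norm (a * b) ≤ r.norm a * r.norm b := by
  simpa [norm] using _root_.norm_mul_le (r.iso a : r.H →L[ℂ] r.H) (r.iso b)

theorem norm_add_le (r : WStarRep A) (a b : A) : r.norm (a + b) ≤ r.norm a + r.norm b := by
  simpa [norm] using _root_.norm_add_le (r.iso a : r.H →L[ℂ] r.H) (r.iso b)

theorem norm_smul (r : WStarRep A) (z : ℂ) (a : A) : r.norm (z • a) = ‖z‖ * r.norm a := by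
  simpa [norm, map_smul r.iso z a] using _root_.norm_smul z (r.iso a : r.H →L[ℂ] r.H)

theorem norm_star (r : WStarRep A) (a : A) : r.norm (star a) = r.norm a := by
  simp [norm, map_star]

theorem norm_star_mul_self (r : WStarRep A) (a : A) :
    r.norm (star a * a) = r.norm a * r.norm a := by
  simpa [norm, map_star] using
    CStarRing.norm_star_mul_self (x := (r.iso a : r.H →L[ℂ] r.H))

theorem norm_nonneg (r : WStarRep A) (a : A) : 0 ≤ r.norm a := _root_.norm_nonneg _

end WStarRep

/-! ## `W*`-categories -/

/-- A `W*`-category: a `*`-category such that `End X` is a `W*`-algebra for every formal finite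
direct sum `X` of objects. -/
class WStarCategory (C : Type u) [Category.{v} C] [Preadditive C] [Linear ℂ C]
    [StarCategory C] : Prop where
  isWStar : ∀ X : Mat_ C, IsWStarAlgebra (End X)

section Norm

variable {C : Type u} [Category.{v} C] [Preadditive C] [Linear ℂ C] [StarCategory C]

/-- `single`, regarded as an element of the endomorphism algebra. -/
def entry (Z : Mat_ C) (i j : Z.ι) (f : Z.X i ⟶ Z.X j) : End Z := End.of (single i j f)

theorem entry_mul (Z : Mat_ C) (i j k : Z.ι) (f : Z.X i ⟶ Z.X j) (g : Z.X j ⟶ Z.X k) :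
    entry Z j k g * entry Z i j f = entry Z i k (f ≫ g) := single_comp i j k f g

theorem entry_add (Z : Mat_ C) (i j : Z.ι) (f g : Z.X i ⟶ Z.X j) :
    entry Z i j (f + g) = entry Z i j f + entry Z i j g := single_add i j f g

theorem entry_smul (Z : Mat_ C) (i j : Z.ι) (r : ℂ) (f : Z.X i ⟶ Z.X j) :
    entry Z i j (r • f) = r • entry Z i j f := single_smul i j r f

theorem star_entry (Z : Mat_ C) (i j : Z.ι) (f : Z.X i ⟶ Z.X j) :
    star (entry Z i j f) = entry Z j i (dag f) := dag_single i j f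

theorem entry_injective (Z : Mat_ C) (i j : Z.ι) : Function.Injective (entry Z i j) := by
  intro f g h
  have h1 : single i j f i j = single i j g i j := congrArg (fun t : Z ⟶ Z => t i j) h
  rwa [single_self, single_self] at h1

/-- A chosen realisation of `End X`; by `WStarRep.norm_map` the norm does not depend on it. -/
def matRep [WStarCategory C] (X : Mat_ C) : WStarRep (End X) :=
  Classical.choice (WStarCategory.isWStar X)

/-- The formal direct sum `c ⊕ d` in `C^⊕`, with `c` at `true` and `d` at `false`. -/
abbrev pair (c d : C) : Mat_ C := { ι := Bool, X := fun b => cond b c d }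

/-- The norm of a morphism `f : c ⟶ d`: the norm of `f`, regarded as an element of the
`W*`-algebra `End(c ⊕ d)`. -/
def homNorm [WStarCategory C] {c d : C} (f : c ⟶ d) : ℝ :=
  (matRep (pair c d)).norm (entry (pair c d) true false f)

/-- The formal direct sum with the single summand `c`. -/
abbrev one (c : C) : Mat_ C := { ι := Unit, X := fun _ => c }

/-- An endomorphism as a one-by-one matrix. -/
def toOne {c : C} (f : c ⟶ c) : End (one c) := End.of (fun _ _ => f : one c ⟶ one c)

/-- The entry of a one-by-one matrix. -/
def ofOne {c : C} (m : End (one c)) : c ⟶ c := (End.asHom m) () ()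

theorem ofOne_injective {c : C} : Function.Injective (ofOne (c := c)) := by
  intro m n h
  exact Mat_.hom_ext _ _ (fun _ _ => h)

/-- The corner embedding of `End c` in a matrix algebra. -/
def corner (Z : Mat_ C) (i : Z.ι) : End (one (Z.X i)) →⋆ₙₐ[ℂ] End Z where
  toFun m := entry Z i i (ofOne m)
  map_smul' r m := entry_smul Z i i r (ofOne m)
  map_zero' := by
    have h := entry_smul Z i i (0 : ℂ) (0 : Z.X i ⟶ Z.X i)
    rw [smul_zero, zero_smul] at h
    exact h
  map_add' m n := entry_add Z i i (ofOne m) (ofOne n)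
  map_mul' m n := by
    have h : ofOne (m * n) = ofOne n ≫ ofOne m :=
      Fintype.sum_unique (fun _ : Unit => ofOne n ≫ ofOne m)
    rw [h, entry_mul]
  map_star' m := (star_entry Z i i (ofOne m)).symm

theorem corner_injective (Z : Mat_ C) (i : Z.ι) : Function.Injective (corner Z i) :=
  fun _ _ h => ofOne_injective (entry_injective Z i i h)

variable [WStarCategory C]

theorem norm_entry_sq (Z : Mat_ C) (r : WStarRep (End Z)) (i j : Z.ι) (f : Z.X i ⟶ Z.X j) :
    r.norm (entry Z i j f) * r.norm (entry Z i j f) =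
      (matRep (one (Z.X i))).norm (toOne (f ≫ dag f)) := by
  rw [← r.norm_star_mul_self, ← WStarRep.norm_map _ r (corner Z i) (corner_injective Z i),
    star_entry, entry_mul]
  rfl

/-- The norm of a morphism may be computed in any realisation of any matrix algebra in which the
morphism occurs as an entry. -/
theorem homNorm_eq (Z : Mat_ C) (r : WStarRep (End Z)) (i j : Z.ι) (f : Z.X i ⟶ Z.X j) :
    homNorm f = r.norm (entry Z i j f) := by
  have h1 := norm_entry_sq Z r i j f
  have h2 := norm_entry_sq (pair (Z.X i) (Z.X j)) (matRep _) true false f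
  exact (mul_self_inj (WStarRep.norm_nonneg _ _) (WStarRep.norm_nonneg _ _)).mp (h2.trans h1.symm)

theorem homNorm_nonneg {c d : C} (f : c ⟶ d) : 0 ≤ homNorm f := WStarRep.norm_nonneg _ _

theorem homNorm_add_le {c d : C} (f g : c ⟶ d) : homNorm (f + g) ≤ homNorm f + homNorm g := by
  have h := WStarRep.norm_add_le (matRep (pair c d)) (entry (pair c d) true false f)
    (entry (pair c d) true false g)
  rwa [← entry_add] at h

theorem homNorm_smul {c d : C} (z : ℂ) (f : c ⟶ d) : homNorm (z • f) = ‖z‖ * homNorm f := by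
  have h := WStarRep.norm_smul (matRep (pair c d)) z (entry (pair c d) true false f)
  rwa [← entry_smul] at h

theorem homNorm_dag {c d : C} (f : c ⟶ d) : homNorm (dag f) = homNorm f := by
  have h := WStarRep.norm_star (matRep (pair c d)) (entry (pair c d) true false f)
  rw [star_entry] at h
  exact (homNorm_eq (pair c d) (matRep _) false true (dag f)).trans h

theorem homNorm_comp_le {c d e : C} (f : c ⟶ d) (g : d ⟶ e) :
    homNorm (f ≫ g) ≤ homNorm f * homNorm g := by
  let Z : Mat_ C := { ι := Option Bool, X := fun t => t.elim e (fun b => cond b c d) }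
  have h0 : entry Z (some false) none g * entry Z (some true) (some false) f =
      entry Z (some true) none (f ≫ g) := entry_mul Z (some true) (some false) none f g
  have h := (congrArg (matRep Z).norm h0.symm).le.trans (WStarRep.norm_mul_le (matRep Z) _ _)
  have e1 : homNorm (f ≫ g) = _ := homNorm_eq Z (matRep Z) (some true) none (f ≫ g)
  have e2 : homNorm f = _ := homNorm_eq Z (matRep Z) (some true) (some false) f
  have e3 : homNorm g = _ := homNorm_eq Z (matRep Z) (some false) none g
  rw [mul_comm, e1, e2, e3]
  exact h

theorem homNorm_id_le (c : C) : homNorm (𝟙 c) ≤ 1 := by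
  have h := (matRep (one c)).norm_star_mul_self (entry (one c) () () (𝟙 c))
  rw [star_entry, entry_mul] at h
  have e : homNorm (𝟙 c) = _ := homNorm_eq (one c) (matRep _) () () (𝟙 c)
  have h2 : (𝟙 c ≫ dag (𝟙 c) : c ⟶ c) = 𝟙 c := by simp
  rw [h2, ← e] at h
  nlinarith [homNorm_nonneg (𝟙 c)]

end Norm

/-! ## Full subcategories of `W*`-categories -/

section FullSub

variable {C : Type u} [Category.{v} C] [Preadditive C] [Linear ℂ C] [StarCategory C]

instance fullSubStar (P : ObjectProperty C) : StarCategory P.FullSubcategory where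
  dag f := ObjectProperty.homMk (dag f.hom)
  dag_dag f := ObjectProperty.hom_ext _ (dag_dag f.hom)
  dag_comp f g := ObjectProperty.hom_ext _ (dag_comp f.hom g.hom)
  dag_add f g := ObjectProperty.hom_ext _ (dag_add f.hom g.hom)
  dag_smul z f := ObjectProperty.hom_ext _ (dag_smul z f.hom)

/-- Matrices over a full subcategory are matrices over the ambient category. -/
abbrev fullSubMat {P : ObjectProperty C} (X : Mat_ P.FullSubcategory) : Mat_ C :=
  { ι := X.ι, X := fun i => (X.X i).obj }

theorem hom_sum {P : ObjectProperty C} {X Y : P.FullSubcategory} {ι : Type*} (s : Finset ι)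
    (f : ι → (X ⟶ Y)) : (∑ i ∈ s, f i).hom = ∑ i ∈ s, (f i).hom :=
  map_sum (AddMonoidHom.mk' (fun g : X ⟶ Y => g.hom) (fun _ _ => rfl)) f s

def fullSubEnd {P : ObjectProperty C} (X : Mat_ P.FullSubcategory) :
    End X ≃⋆ₐ[ℂ] End (fullSubMat X) where
  toFun m := End.of (fun i j => ((End.asHom m) i j).hom : fullSubMat X ⟶ fullSubMat X)
  invFun m := End.of (fun i j => ObjectProperty.homMk ((End.asHom m) i j) : X ⟶ X)
  left_inv _ := rfl
  right_inv _ := rfl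
  map_mul' m n := by
    refine Mat_.hom_ext _ _ (fun i j => ?_)
    exact hom_sum Finset.univ (fun l => (End.asHom n) i l ≫ (End.asHom m) l j)
  map_add' _ _ := rfl
  map_star' _ := rfl
  map_smul' _ _ := rfl

instance fullSubWStar [WStarCategory C] (P : ObjectProperty C) :
    WStarCategory P.FullSubcategory where
  isWStar X := by
    obtain ⟨r⟩ := WStarCategory.isWStar (fullSubMat X)
    exact ⟨{ H := r.H, S := r.S, iso := (fullSubEnd X).trans r.iso }⟩

end FullSub

/-! ## Order, normality, functors -/

section Order

variable (A : Type*) [Ring A] [StarRing A]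

/-- The cone of positive elements of a `*`-algebra: finite sums of elements `a* a` (in a
`W*`-algebra every such sum is again of the form `a* a`). -/
def posCone : AddSubmonoid A := AddSubmonoid.closure (Set.range fun a : A => star a * a)

variable {A}

/-- The order relation `a ≤ b` of a `*`-algebra: `b - a` is positive. -/
def StarLE (a b : A) : Prop := b - a ∈ posCone A

/-- `s` is the supremum of the set `D`. -/
def IsStarSup (D : Set A) (s : A) : Prop :=
  (∀ a ∈ D, StarLE a s) ∧ ∀ b, (∀ a ∈ D, StarLE a b) → StarLE s b

/-- A map is normal if it preserves suprema of bounded increasing nets (bounded upwards directed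
sets) of positive elements. -/
def IsNormalMap {B : Type*} [Ring B] [StarRing B] (f : A → B) : Prop :=
  ∀ D : Set A, D.Nonempty → DirectedOn StarLE D → (∀ a ∈ D, a ∈ posCone A) →
    ∀ s, IsStarSup D s → IsStarSup (f '' D) (f s)

end Order

section Functors

variable {C : Type u} [Category.{v} C] [Preadditive C] [Linear ℂ C] [StarCategory C]
variable {D : Type u'} [Category.{w} D] [Preadditive D] [Linear ℂ D] [StarCategory D]

/-- The image of a formal finite direct sum under a functor. -/
abbrev matObj (F : C ⥤ D) (X : Mat_ C) : Mat_ D := { ι := X.ι, X := fun i => F.obj (X.X i) }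

/-- The map `End(X) → End(F(X))` for `X ∈ C^⊕`, given by applying `F` to the matrix entries. -/
def matEndMap (F : C ⥤ D) (X : Mat_ C) (f : End X) : End (matObj F X) :=
  End.of (fun i j => F.map ((End.asHom f) i j) : matObj F X ⟶ matObj F X)

/-- A functor between `W*`-categories: a linear `*`-functor which induces normal homomorphisms
`End(X) → End(F(X))` for all `X ∈ C^⊕`. -/
structure IsWStarFunctor (F : C ⥤ D) : Prop where
  additive : F.Additive
  linear : F.Linear ℂ
  map_dag : ∀ {X Y : C} (f : X ⟶ Y), F.map (dag f) = dag (F.map f)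
  normal : ∀ X : Mat_ C, IsNormalMap (matEndMap F X)

end Functors

/-! ## Orthogonal direct sums, Cauchy completeness, generators -/

section Sums

variable {C : Type u} [Category.{v} C] [Preadditive C] [Linear ℂ C] [StarCategory C]

/-- The endomorphism `ι ι*` of `x` attached to a morphism `ι : c ⟶ x`. -/
def rangeEnd {c x : C} (ι : c ⟶ x) : End x := End.of (dag ι ≫ ι)

/-- The morphisms `ι i : c i ⟶ x` exhibit `x` as the orthogonal direct sum of the objects `c i`:
`ι i* ι j = δ i j` and `∑ ι i ι i* = 1`, where the sum is the supremum of its finite subsums. -/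
structure IsOrthogonalDirectSum {J : Type w} {c : J → C} {x : C} (ι : ∀ j, c j ⟶ x) : Prop where
  isometry : ∀ j, ι j ≫ dag (ι j) = 𝟙 (c j)
  orthogonal : ∀ j k, j ≠ k → ι j ≫ dag (ι k) = 0
  sum_eq : IsStarSup (Set.range fun F : Finset J => ∑ j ∈ F, rangeEnd (ι j)) (1 : End x)

variable (C) in
/-- Every projection `p` is of the form `p = ι ι*` with `ι* ι = 1`. -/
def IsIdempotentCompleteStar : Prop :=
  ∀ (x : C) (p : x ⟶ x), p ≫ p = p → dag p = p →
    ∃ (y : C) (ι : y ⟶ x), dag ι ≫ ι = p ∧ ι ≫ dag ι = 𝟙 y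

variable (C) in
/-- Every set-indexed collection of objects has an orthogonal direct sum. Sets are the elements of
the universe in which the hom-spaces live. -/
def HasAllDirectSums : Prop :=
  ∀ (J : Type v) (c : J → C), ∃ (x : C) (ι : ∀ j, c j ⟶ x), IsOrthogonalDirectSum ι

variable (C) in
/-- Cauchy completeness. -/
def IsCauchyComplete : Prop := HasAllDirectSums C ∧ IsIdempotentCompleteStar C

/-- A set `S` of objects generates `C` if every nonzero object `(x, p)` of the idempotent completion
receives a nonzero morphism `f = p f` from some member of `S`. -/
def IsGenerating (S : Set C) : Prop :=
  ∀ (x : C) (p : x ⟶ x), p ≫ p = p → dag p = p → p ≠ 0 →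
    ∃ s ∈ S, ∃ f : s ⟶ x, f ≫ p = f ∧ f ≠ 0

/-- A family of objects is orthogonal if there are no nonzero morphisms between distinct members. -/
def IsOrthogonalFamily {J : Type w} (c : J → C) : Prop :=
  ∀ j k, j ≠ k → ∀ f : c j ⟶ c k, f = 0

/-- The full subcategory generated by an object `c`: the essential image of the canonical functor
from the Cauchy completion of `End c`, which sends a formal direct sum of projections of `c` to an
orthogonal direct sum of objects which split these projections. -/
def generatedBy (c : C) : ObjectProperty C := fun x =>
  ∃ (J : Type v) (p : J → (c ⟶ c)) (z : J → C) (s : ∀ j, z j ⟶ c) (y : C) (ι : ∀ j, z j ⟶ y),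
    (∀ j, dag (s j) ≫ s j = p j ∧ s j ≫ dag (s j) = 𝟙 (z j)) ∧
    IsOrthogonalDirectSum ι ∧ Nonempty (x ≅ y)

/-- The full subcategory generated by a collection of objects: the one generated by their
orthogonal direct sum. -/
def generatedByFamily {J : Type w} (c : J → C) : ObjectProperty C := fun x =>
  ∃ (s : C) (ι : ∀ j, c j ⟶ s), IsOrthogonalDirectSum ι ∧ generatedBy s x

/-- The orthogonal complement of `D` inside `E`. -/
def complementIn (D E : ObjectProperty C) : ObjectProperty C := fun x =>
  E x ∧ ∀ d, D d → ∀ f : d ⟶ x, f = 0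

theorem generatedBy_of_isometry {c x : C} (s : x ⟶ c) (hs : s ≫ dag s = 𝟙 x) :
    generatedBy c x := by
  refine ⟨PUnit, fun _ => dag s ≫ s, fun _ => x, fun _ => s, x, fun _ => 𝟙 x,
    fun _ => ⟨rfl, hs⟩, ⟨by simp, fun j k h => (h rfl).elim, ?_⟩, ⟨Iso.refl x⟩⟩
  have h1 : rangeEnd (𝟙 x) = 1 := by simp [rangeEnd, End.of]
  constructor
  · rintro _ ⟨F, rfl⟩
    have hF : F = ∅ ∨ F = {PUnit.unit} := by
      by_cases h : PUnit.unit ∈ F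
      · exact Or.inr (Finset.ext fun a => by cases a; simp [h])
      · exact Or.inl (Finset.ext fun a => by cases a; simp [h])
    rcases hF with rfl | rfl
    · exact AddSubmonoid.subset_closure ⟨(1 : End x), by
        simp only [star_one, one_mul, Finset.sum_empty, sub_zero]⟩
    · simp only [Finset.sum_singleton, h1, StarLE, sub_self]
      exact zero_mem _
  · intro b hb
    have h := hb _ ⟨{PUnit.unit}, rfl⟩
    simpa only [Finset.sum_singleton, h1] using h

theorem generatedByFamily_mem (hC : HasAllDirectSums C) {J : Type v} (c : J → C) (j : J) :
    generatedByFamily c (c j) := by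
  obtain ⟨x, ι, h⟩ := hC J c
  exact ⟨x, ι, h, generatedBy_of_isometry (ι j) (h.isometry j)⟩

end Sums

/-! ## Orthogonal direct sums of `W*`-categories -/

/-- An object of `⊞ A i`: a formal sum of objects of the categories `A i`. -/
structure Boxplus {I : Type w} (A : I → Type u) where
  obj : ∀ i, A i

section Boxplus

variable {I : Type w} {A : I → Type u} [∀ i, Category.{v} (A i)] [∀ i, Preadditive (A i)]
  [∀ i, Linear ℂ (A i)] [∀ i, StarCategory (A i)] [∀ i, WStarCategory (A i)]

/-- The bounded families of morphisms, as a complex vector space. -/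
def boundedFamilies (X Y : Boxplus A) : Submodule ℂ (∀ i, X.obj i ⟶ Y.obj i) where
  carrier := {f | ∃ K : ℝ, ∀ i, homNorm (f i) ≤ K}
  add_mem' := by
    rintro f g ⟨K, hK⟩ ⟨L, hL⟩
    exact ⟨K + L, fun i => (homNorm_add_le _ _).trans (add_le_add (hK i) (hL i))⟩
  zero_mem' := ⟨0, fun i => by
    have h := homNorm_smul (0 : ℂ) (0 : X.obj i ⟶ Y.obj i)
    rw [smul_zero, _root_.norm_zero, zero_mul] at h
    exact h.le⟩
  smul_mem' := by
    rintro z f ⟨K, hK⟩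
    exact ⟨‖z‖ * K, fun i => (homNorm_smul z (f i)).le.trans
      (mul_le_mul_of_nonneg_left (hK i) (_root_.norm_nonneg z))⟩

/-- Morphisms of `⊞ A i` are bounded families of morphisms, composed componentwise. -/
instance boxplusCategory : Category.{max w v} (Boxplus A) where
  Hom X Y := boundedFamilies X Y
  id X := ⟨fun i => 𝟙 (X.obj i), 1, fun i => homNorm_id_le _⟩
  comp f g := ⟨fun i => f.1 i ≫ g.1 i, by
    obtain ⟨K, hK⟩ := f.2
    obtain ⟨L, hL⟩ := g.2
    exact ⟨K * L, fun i => (homNorm_comp_le _ _).trans (mul_le_mul (hK i) (hL i)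
      (homNorm_nonneg _) ((homNorm_nonneg _).trans (hK i)))⟩⟩
  id_comp f := Subtype.ext (funext fun i => Category.id_comp (f.1 i))
  comp_id f := Subtype.ext (funext fun i => Category.comp_id (f.1 i))
  assoc f g h := Subtype.ext (funext fun i => Category.assoc (f.1 i) (g.1 i) (h.1 i))

/-- The `i`-th component of a morphism of `⊞ A i`. -/
def Boxplus.app {X Y : Boxplus A} (f : X ⟶ Y) (i : I) : X.obj i ⟶ Y.obj i := f.1 i

instance boxplusPreadditive : Preadditive (Boxplus A) where
  homGroup X Y := inferInstanceAs (AddCommGroup (boundedFamilies X Y))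
  add_comp _ _ _ f f' g :=
    Subtype.ext (funext fun i => Preadditive.add_comp _ _ _ (f.1 i) (f'.1 i) (g.1 i))
  comp_add _ _ _ f g g' :=
    Subtype.ext (funext fun i => Preadditive.comp_add _ _ _ (f.1 i) (g.1 i) (g'.1 i))

instance boxplusLinear : Linear ℂ (Boxplus A) where
  homModule X Y := inferInstanceAs (Module ℂ (boundedFamilies X Y))
  smul_comp _ _ _ r f g :=
    Subtype.ext (funext fun i => Linear.smul_comp _ _ _ r (f.1 i) (g.1 i))
  comp_smul _ _ _ f r g :=
    Subtype.ext (funext fun i => Linear.comp_smul _ _ _ (f.1 i) r (g.1 i))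

instance boxplusStar : StarCategory (Boxplus A) where
  dag f := ⟨fun i => dag (f.1 i), by
    obtain ⟨K, hK⟩ := f.2
    exact ⟨K, fun i => (homNorm_dag (f.1 i)).le.trans (hK i)⟩⟩
  dag_dag f := Subtype.ext (funext fun i => dag_dag (f.1 i))
  dag_comp f g := Subtype.ext (funext fun i => dag_comp (f.1 i) (g.1 i))
  dag_add f g := Subtype.ext (funext fun i => dag_add (f.1 i) (g.1 i))
  dag_smul z f := Subtype.ext (funext fun i => dag_smul z (f.1 i))

end Boxplus

/-- A splitting `C = ⊞ D i` of a `W*`-category into full subcategories `D i`: an equivalence of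
`W*`-categories `C ≌ ⊞ D i` which sends `x` to a family of objects of which `x` is, naturally in
`x`, the orthogonal direct sum. Its components are the orthogonal projections `C ↠ D i`. -/
structure OrthogonalSplitting {C : Type u} [Category.{v} C] [Preadditive C] [Linear ℂ C]
    [StarCategory C] [WStarCategory C] {I : Type w} (D : I → ObjectProperty C) where
  functor : C ⥤ Boxplus (fun i => (D i).FullSubcategory)
  isWStarFunctor : IsWStarFunctor functor
  isEquivalence : functor.IsEquivalence
  incl : ∀ (x : C) (i : I), ((functor.obj x).obj i).obj ⟶ x
  isOrthogonalDirectSum : ∀ x, IsOrthogonalDirectSum (incl x)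
  natural : ∀ {x y : C} (f : x ⟶ y) (i : I),
    (Boxplus.app (functor.map f) i).hom ≫ incl y i = incl x i ≫ f

/-- The orthogonal projection of an object onto the `i`-th summand. -/
def OrthogonalSplitting.proj {C : Type u} [Category.{v} C] [Preadditive C] [Linear ℂ C]
    [StarCategory C] [WStarCategory C] {I : Type w} {D : I → ObjectProperty C}
    (S : OrthogonalSplitting D) (i : I) (x : C) : (D i).FullSubcategory :=
  (S.functor.obj x).obj i

/-! ## The Gram–Schmidt subcategories -/

section GramSchmidt

variable {C : Type u} [Category.{v} C] [Preadditive C] [Linear ℂ C] [StarCategory C]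
variable {I : Type v} [LinearOrder I] (c : I → C)

/-- `C_{<i}`, the full subcategory generated by the `c j` with `j < i`. -/
def spanLT (i : I) : ObjectProperty C := generatedByFamily (fun j : Set.Iio i => c j)

/-- `C_{≤i}`, the full subcategory generated by the `c j` with `j ≤ i`. -/
def spanLE (i : I) : ObjectProperty C := generatedByFamily (fun j : Set.Iic i => c j)

/-- `C_i`, the orthogonal complement of `C_{<i}` inside `C_{≤i}`. -/
def gsPart (i : I) : ObjectProperty C := complementIn (spanLT c i) (spanLE c i)

/-- The two full subcategories `C_{<i}` (at `false`) and `C_i` (at `true`) of `C_{≤i}`. -/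
def gsPair (i : I) (b : Bool) : ObjectProperty (spanLE c i).FullSubcategory :=
  (if b then gsPart c i else spanLT c i).inverseImage (spanLE c i).ι

/-- The object `c i` of `C_{≤i}`. -/
def genObj (hC : HasAllDirectSums C) (i : I) : (spanLE c i).FullSubcategory :=
  ⟨c i, generatedByFamily_mem hC (fun j : Set.Iic i => c j) ⟨i, le_refl i⟩⟩

/-- The orthogonal projection `Q_i : C_{≤i} ↠ C_i` (on objects) which belongs to a splitting
`C_{≤i} = C_{<i} ⊞ C_i`. -/
def gsProj [WStarCategory C] {c : I → C} {i : I} (S : OrthogonalSplitting (gsPair c i))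
    (x : (spanLE c i).FullSubcategory) : (gsPart c i).FullSubcategory :=
  ⟨(S.proj true x).obj.obj, (S.proj true x).property⟩

end GramSchmidt

end

end WStarCat

open WStarCat WStarCat.StarCategory

/-!
Work with the supports of an object `x` for a family of objects: the smallest projection `e` of
`x` through which all morphisms from the members of the family factor (`IsSupport`). An object
belongs to the full subcategory generated by the family precisely if its support is the identity,
that is, if the morphisms from the family to it are jointly epimorphic (`generatedByFamily_iff`).
The point is that the part of `x` cut out by the support is an orthogonal direct sum of subobjects
of the orthogonal direct sum `s` of the family: by Zorn's lemma there is a maximal orthogonal family of subobjects of `x`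
which are isomorphic to subobjects of `s` (`exists_maximal_isometries`), and it exhausts the
support, because every nonzero morphism `f : s ⟶ x` provides nonzero isomorphic subobjects of `s`
and `x`. Instead of the polar decomposition of `f`, this uses the support projection of `(f f* -
ε)₊`, on which `f f*` is invertible (`WStarRep.exists_projection_of_pos`).

If `e i` and `e' i` are the supports of `x` for the `c j` with `j < i` and with `j ≤ i`, then the
projections `e' i - e i` are orthogonal and split to objects of `C_i`. A morphism which vanishes
on all of them vanishes on every `e' i`, by transfinite induction, hence is zero because the `c i`
generate; so `x` is the orthogonal direct sum of these objects (`exists_gsPart`). The pair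
`C_{<i}`, `C_i` is treated in the same way (`exists_gsPair`). As there are no nonzero morphisms
between objects of different summands, such objectwise decompositions are automatically functorial
and define a fully faithful `*`-functor to `⊞ D i`. Fullness means that bounded diagonal families
of morphisms can be summed, which follows from the weak compactness of balls of operators;
normality is automatic, since suprema are preserved by `*`-isomorphisms (`ObjectwiseSplitting`).

The remaining assertions follow from `c i = P_i(c i) ⊕ Q_i(c i)`, where `P_i(c i)` belongs to
`C_{<i}`, and from the orthogonality of the `C_i`.
-/

namespace WStarCat

noncomputable section

/-! ### Bounded nets of operators -/

section Operators

variable {H : Type*} [NormedAddCommGroup H] [InnerProductSpace ℂ H] [CompleteSpace H]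

open Filter Topology in
/-- The closed balls of `B(H)` are compact in the weak operator topology, phrased with
ultrafilters. -/
theorem exists_weak_limit {ι : Type*} (U : Ultrafilter ι) (a : ι → H →L[ℂ] H) (K : ℝ)
    (ha : ∀ i, ‖a i‖ ≤ K) :
    ∃ T : H →L[ℂ] H, ∀ h k, Tendsto (fun i => inner ℂ (a i h) k) U (𝓝 (inner ℂ (T h) k)) := by
  have hb : ∀ h k i, ‖inner ℂ (a i h) k‖ ≤ K * ‖h‖ * ‖k‖ := fun h k i =>
    (norm_inner_le_norm _ _).trans (mul_le_mul_of_nonneg_right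
      (((a i).le_opNorm h).trans (mul_le_mul_of_nonneg_right (ha i) (norm_nonneg h)))
      (norm_nonneg k))
  have hlim : ∀ h k, ∃ z : ℂ, Tendsto (fun i => inner ℂ (a i h) k) U (𝓝 z) := by
    intro h k
    obtain ⟨z, -, hz⟩ := (isCompact_closedBall (0 : ℂ) (K * ‖h‖ * ‖k‖)).ultrafilter_le_nhds'
      (U.map (fun i => inner ℂ (a i h) k)) (Filter.mem_map.mpr (Filter.univ_mem' fun i => by
        simpa using hb h k i))
    exact ⟨z, hz⟩
  choose B hB using hlim
  let b : H →ₗ⋆[ℂ] H →ₗ[ℂ] ℂ := LinearMap.mk₂'ₛₗ (starRingEnd ℂ) (RingHom.id ℂ) B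
    (fun h h' k => tendsto_nhds_unique (hB (h + h') k) (by
      simpa only [map_add, inner_add_left] using (hB h k).add (hB h' k)))
    (fun z h k => tendsto_nhds_unique (hB (z • h) k) (by
      simpa only [map_smul, inner_smul_left, smul_eq_mul] using (hB h k).const_mul _))
    (fun h k k' => tendsto_nhds_unique (hB h (k + k')) (by
      simpa only [inner_add_right] using (hB h k).add (hB h k')))
    (fun z h k => tendsto_nhds_unique (hB h (z • k)) (by
      simpa only [inner_smul_right, smul_eq_mul, RingHom.id_apply] using (hB h k).const_mul z))
  have hbd : ∀ h k, ‖b h k‖ ≤ K * ‖h‖ * ‖k‖ := fun h k =>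
    le_of_tendsto (hB h k).norm (Filter.Eventually.of_forall fun i => hb h k i)
  refine ⟨InnerProductSpace.continuousLinearMapOfBilin (b.mkContinuous₂ K hbd), fun h k => ?_⟩
  rw [InnerProductSpace.continuousLinearMapOfBilin_apply]
  exact hB h k

theorem mem_of_commute_commutant (S : VonNeumannAlgebra H) {T : H →L[ℂ] H}
    (h : ∀ y ∈ S.commutant, Commute T y) : T ∈ S := by
  rw [← S.commutant_commutant, VonNeumannAlgebra.mem_commutant_iff]
  exact fun g hg => (h g hg).eq.symm

open Filter Topology in
theorem mem_of_weak_limit (S : VonNeumannAlgebra H) {ι : Type*}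
    (U : Ultrafilter ι) {a : ι → H →L[ℂ] H} (ha : ∀ i, a i ∈ S) {T : H →L[ℂ] H}
    (hT : ∀ h k, Tendsto (fun i => inner ℂ (a i h) k) U (𝓝 (inner ℂ (T h) k))) : T ∈ S := by
  refine mem_of_commute_commutant S fun y hy => ?_
  ext h
  refine ext_inner_right ℂ fun k => ?_
  refine tendsto_nhds_unique (hT (y h) k) ?_
  have h1 := hT h (ContinuousLinearMap.adjoint y k)
  simp only [ContinuousLinearMap.adjoint_inner_right] at h1
  refine h1.congr fun i => ?_
  have := VonNeumannAlgebra.mem_commutant_iff.mp hy (a i) (ha i)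
  exact congrArg (fun T : H →L[ℂ] H => inner ℂ (T h) k) this.symm

theorem cfc_mem_vonNeumannAlgebra (S : VonNeumannAlgebra H) {a : H →L[ℂ] H} (ha : a ∈ S)
    (f : ℝ → ℝ) : cfc f a ∈ S :=
  mem_of_commute_commutant S fun _ hy =>
    Commute.cfc_real (VonNeumannAlgebra.mem_commutant_iff.mp hy a ha) f

/-- The kernel of an element of a von Neumann algebra is invariant under the commutant, so that the
projection onto it belongs to the algebra. -/
theorem starProjection_ker_mem (S : VonNeumannAlgebra H) {a : H →L[ℂ] H}
    (ha : a ∈ S) : a.ker.starProjection ∈ S := by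
  rw [VonNeumannAlgebra.IsStarProjection.mem_iff (isStarProjection_starProjection)]
  intro y hy
  rw [Submodule.range_starProjection, Module.End.mem_invtSubmodule]
  intro h hh
  have := VonNeumannAlgebra.mem_commutant_iff.mp hy a ha
  have h1 : a h = 0 := hh
  have h2 : a (y h) = y (a h) := congrArg (fun T : H →L[ℂ] H => T h) this
  change a (y h) = 0
  rw [h2, h1, map_zero]

end Operators

/-! ### `W*`-algebras -/

namespace WStarRep

variable {A : Type v} [Ring A] [Algebra ℂ A] [StarRing A] (r : WStarRep A)

/-- The faithful representation on `r.H` which underlies a realisation `r`. -/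
def op : A →⋆ₐ[ℂ] (r.H →L[ℂ] r.H) := r.S.toStarSubalgebra.subtype.comp r.iso.toStarAlgHom

theorem op_mem (a : A) : r.op a ∈ r.S := (r.iso a).2

theorem op_injective : Function.Injective r.op :=
  fun _ _ h => r.iso.injective (Subtype.ext h)

theorem exists_op_eq {T : r.H →L[ℂ] r.H} (hT : T ∈ r.S) : ∃ a, r.op a = T :=
  ⟨r.iso.symm ⟨T, hT⟩, congrArg Subtype.val (r.iso.apply_symm_apply ⟨T, hT⟩)⟩

theorem exists_mul_self_of_op_nonneg {a : A} (h : 0 ≤ r.op a) : ∃ b, star b = b ∧ b * b = a := by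
  obtain ⟨b, hb⟩ := r.exists_op_eq (cfc_mem_vonNeumannAlgebra r.S (r.op_mem a) Real.sqrt)
  have hsa : IsSelfAdjoint (r.op a) := IsSelfAdjoint.of_nonneg h
  refine ⟨b, r.op_injective ?_, r.op_injective ?_⟩
  · rw [map_star, hb, IsSelfAdjoint.star_eq (cfc_predicate _ _)]
  · rw [map_mul, hb, ← cfc_mul Real.sqrt Real.sqrt (r.op a)]
    conv_rhs => rw [← cfc_id' ℝ (r.op a)]
    exact cfc_congr fun t ht => Real.mul_self_sqrt (spectrum_nonneg_of_nonneg h ht)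

theorem op_nonneg_iff {a : A} : 0 ≤ r.op a ↔ a ∈ posCone A := by
  constructor
  · intro h
    obtain ⟨b, hb, hb'⟩ := r.exists_mul_self_of_op_nonneg h
    exact AddSubmonoid.subset_closure ⟨b, by simp only [hb, hb']⟩
  · intro h
    induction h using AddSubmonoid.closure_induction with
    | mem x hx =>
      obtain ⟨b, rfl⟩ := hx
      simp only [map_mul, map_star]
      exact star_mul_self_nonneg _
    | zero => simp
    | add x y _ _ hx hy => rw [map_add]; exact add_nonneg hx hy

theorem starLE_iff {a b : A} : StarLE a b ↔ r.op a ≤ r.op b := by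
  rw [StarLE, ← r.op_nonneg_iff, map_sub, sub_nonneg]

include r in
theorem exists_mul_self_of_mem_posCone {a : A} (ha : a ∈ posCone A) :
    ∃ b, star b = b ∧ b * b = a :=
  r.exists_mul_self_of_op_nonneg (r.op_nonneg_iff.mpr ha)

include r in
theorem eq_zero_of_star_mul_self {a : A} (h : star a * a = 0) : a = 0 := by
  apply r.op_injective
  have h1 := congrArg r.op h
  rw [map_mul, map_star, map_zero] at h1
  rw [map_zero]
  exact (CStarRing.star_mul_self_eq_zero_iff _).mp h1

theorem isStarProjection_op_sum {J : Type*} {p : J → A} (hp : ∀ j, star (p j) = p j)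
    (hpp : ∀ j, p j * p j = p j) (ho : ∀ j k, j ≠ k → p j * p k = 0) (F : Finset J) :
    IsStarProjection (r.op (∑ j ∈ F, p j)) := by
  constructor
  · rw [IsIdempotentElem, ← map_mul, Finset.sum_mul_sum]
    congr 1
    refine Finset.sum_congr rfl fun j hj => ?_
    rw [Finset.sum_eq_single_of_mem j hj fun k _ hk => ho j k hk.symm, hpp]
  · rw [IsSelfAdjoint, ← map_star, star_sum]
    simp only [hp]

include r in
/-- A positive element which is annihilated by a family of orthogonal projections with supremum `1`
vanishes. -/
theorem eq_zero_of_isStarSup {J : Type*} {p : J → A} (hp : ∀ j, star (p j) = p j)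
    (hpp : ∀ j, p j * p j = p j) (ho : ∀ j k, j ≠ k → p j * p k = 0)
    (hs : IsStarSup (Set.range fun F : Finset J => ∑ j ∈ F, p j) 1) {a : A} (ha : a ∈ posCone A)
    (h : ∀ j, a * p j = 0) : a = 0 := by
  have hT := r.op_nonneg_iff.mpr ha
  by_contra h0
  have hn : 0 < ‖r.op a‖ := norm_pos_iff.mpr fun h1 => h0 (r.op_injective (by rw [h1, map_zero]))
  -- After rescaling, `a ≤ 1`, so that `1 - a` is an upper bound of the partial sums.
  set z : ℂ := ((‖r.op a‖⁻¹ : ℝ) : ℂ)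
  set T := r.op (z • a) with hTz
  have hTe : T = ‖r.op a‖⁻¹ • r.op a := by
    rw [hTz, map_smul]; exact Complex.coe_smul _ _
  have hT0 : 0 ≤ T := by rw [hTe]; exact smul_nonneg (inv_nonneg.mpr hn.le) hT
  have hT1 : T ≤ 1 := by
    rw [← CStarAlgebra.norm_le_one_iff_of_nonneg T hT0, hTe, _root_.norm_smul, norm_inv, norm_norm,
      inv_mul_cancel₀ hn.ne']
  have hb : ∀ x ∈ Set.range (fun F : Finset J => ∑ j ∈ F, p j), StarLE x (1 - z • a) := by
    rintro _ ⟨F, rfl⟩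
    have hP := r.isStarProjection_op_sum hp hpp ho F
    rw [r.starLE_iff, map_sub, map_one]
    set P := r.op (∑ j ∈ F, p j) with hPdef
    have hTP : T * P = 0 := by
      rw [hTz, hPdef, ← map_mul, Finset.mul_sum]
      simp [h]
    have hPT : P * T = 0 := by
      have h1 := congrArg star hTP
      rwa [star_mul, hP.isSelfAdjoint.star_eq, (IsSelfAdjoint.of_nonneg hT0).star_eq,
        star_zero] at h1
    have hc := star_left_conjugate_nonneg (sub_nonneg.mpr hT1) (1 - P)
    rw [star_sub, star_one, hP.isSelfAdjoint.star_eq] at hc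
    have he : (1 - P) * (1 - T) * (1 - P) = 1 - T - P := by
      have := hP.isIdempotentElem.eq
      simp only [sub_mul, mul_sub, one_mul, mul_one, hTP, hPT, this, zero_mul]
      abel
    rw [he] at hc
    exact sub_nonneg.mp hc
  have h1 := r.starLE_iff.mp (hs.2 _ hb)
  rw [map_sub, map_one] at h1
  have h2 : T ≤ 0 := by rwa [le_sub_self_iff] at h1
  have h3 : T = 0 := le_antisymm h2 hT0
  rw [hTe, smul_eq_zero, inv_eq_zero] at h3
  exact h3.elim hn.ne' fun h4 => hn.ne' (by rw [h4, norm_zero])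

include r in
/-- A nonzero positive element `a` dominates a nonzero projection up to conjugation: cutting down
by the support projection `p` of `(a - ε)₊`, on which `a ≥ ε` is invertible, gives
`w a w* = p`. -/
theorem exists_projection_of_pos {a : A} (ha : a ∈ posCone A) (h0 : a ≠ 0) :
    ∃ p w : A, p ≠ 0 ∧ p * p = p ∧ star p = p ∧ w * a * star w = p := by
  have hT := r.op_nonneg_iff.mpr ha
  set T := r.op a with hTdef
  have hsa : IsSelfAdjoint T := IsSelfAdjoint.of_nonneg hT
  have hT0 : T ≠ 0 := fun h => h0 (r.op_injective (by rw [map_zero]; exact h))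
  have hn : 0 < ‖T‖ := norm_pos_iff.mpr hT0
  set ε : ℝ := ‖T‖ / 2 with hεdef
  have hε : 0 < ε := half_pos hn
  set f : ℝ → ℝ := fun t => max (t - ε) 0 with hf
  set g : ℝ → ℝ := fun t => (Real.sqrt (max t ε))⁻¹ with hg
  have hgc : Continuous g :=
    Continuous.inv₀ (by fun_prop) fun t =>
      (Real.sqrt_pos.mpr (lt_of_lt_of_le hε (le_max_right t ε))).ne'
  have hfc : Continuous f := by fun_prop
  have hh0 : cfc f T ≠ 0 := by
    intro h
    have h1 : T = cfc (fun t => min t ε) T + cfc f T := by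
      rw [← cfc_add (a := T) (fun t => min t ε) f (by fun_prop) (by fun_prop)]
      conv_lhs => rw [← cfc_id' ℝ T]
      refine cfc_congr fun t _ => ?_
      simp only [hf]
      rcases le_total t ε with ht | ht
      · rw [min_eq_left ht, max_eq_right (by linarith), add_zero]
      · rw [min_eq_right ht, max_eq_left (by linarith)]; ring
    have h2 : ‖cfc (fun t => min t ε) T‖ ≤ ε := norm_cfc_le hε.le fun t ht => by
      have h3 := spectrum_nonneg_of_nonneg hT ht
      rw [Real.norm_of_nonneg (le_min h3 hε.le)]
      exact min_le_right _ _
    rw [h, add_zero] at h1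
    rw [← h1] at h2
    linarith
  -- `a` is inverted by `g(a)²` on the support of `(a - ε)₊`.
  have hk : cfc f T * (cfc g T * T * cfc g T - 1) = 0 := by
    have h1 : cfc g T * T * cfc g T = cfc (fun t => g t * t * g t) T := by
      rw [cfc_mul (a := T) (fun t => g t * t) g (by fun_prop) (by fun_prop),
        cfc_mul (a := T) g (fun t => t) (by fun_prop) (by fun_prop), cfc_id' ℝ T]
    rw [h1, mul_sub, mul_one, ← cfc_mul (a := T) f _ (by fun_prop) (by fun_prop), sub_eq_zero]
    refine cfc_congr fun t _ => ?_
    simp only [hf, hg]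
    rcases le_total t ε with ht | ht
    · rw [max_eq_right (a := t - ε) (by linarith), zero_mul]
    · have hs := Real.mul_self_sqrt (hε.le.trans ht)
      have hs0 := (Real.sqrt_pos.mpr (hε.trans_le ht)).ne'
      rw [max_eq_left ht]
      field_simp
      rw [sq, hs, mul_comm]
  obtain ⟨e, he⟩ := r.exists_op_eq (starProjection_ker_mem r.S
    (cfc_mem_vonNeumannAlgebra r.S (r.op_mem a) f))
  obtain ⟨b, hb⟩ := r.exists_op_eq (cfc_mem_vonNeumannAlgebra r.S (r.op_mem a) g)
  set E := (cfc f T).ker.starProjection with hE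
  have hEp : IsStarProjection E := isStarProjection_starProjection
  have hEk : E * (cfc g T * T * cfc g T - 1) = cfc g T * T * cfc g T - 1 := by
    ext x
    refine Submodule.starProjection_eq_self_iff.mpr ?_
    exact congrArg (fun R : r.H →L[ℂ] r.H => R x) hk
  have hhE : cfc f T * E = 0 := by
    ext x
    exact Submodule.starProjection_apply_mem (cfc f T).ker x
  have hbs : star b = b := r.op_injective (by
    rw [map_star, hb]; exact IsSelfAdjoint.star_eq (cfc_predicate _ _))
  have hes : star e = e := r.op_injective (by rw [map_star, he]; exact hEp.isSelfAdjoint.star_eq)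
  have hee : e * e = e := r.op_injective (by rw [map_mul, he]; exact hEp.isIdempotentElem.eq)
  have hek : e * (b * a * b - 1) = b * a * b - 1 := r.op_injective (by
    simp only [map_mul, map_sub, map_one, he, hb]; exact hEk)
  refine ⟨1 - e, (1 - e) * b, ?_, ?_, ?_, ?_⟩
  · intro h
    have h1 : E = 1 := by rw [← he, ← sub_eq_zero.mp h, map_one]
    rw [h1, mul_one] at hhE
    exact hh0 hhE
  · simp only [sub_mul, mul_sub, one_mul, mul_one, hee, sub_self, sub_zero]
  · rw [star_sub, star_one, hes]
  · have h1 : (1 - e) * (b * a * b) = 1 - e := by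
      have : (1 - e) * (b * a * b - 1) = 0 := by rw [sub_mul, one_mul, hek, sub_self]
      rwa [mul_sub, mul_one, sub_eq_zero] at this
    calc (1 - e) * b * a * star ((1 - e) * b) = (1 - e) * (b * a * b) * (1 - e) := by
          rw [star_mul, star_sub, star_one, hes, hbs]; simp only [mul_assoc]
      _ = 1 - e := by
          rw [h1]; simp only [sub_mul, mul_sub, one_mul, mul_one, hee, sub_self, sub_zero]

open Filter Topology in
include r in
/-- Orthogonal projections of a `W*`-algebra have a supremum, which is again a projection. -/
theorem exists_isStarSup_sum {J : Type*} {p : J → A} (hp : ∀ j, star (p j) = p j)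
    (hpp : ∀ j, p j * p j = p j) (ho : ∀ j k, j ≠ k → p j * p k = 0) :
    ∃ e : A, star e = e ∧ e * e = e ∧ (∀ j, e * p j = p j) ∧ (∀ a, (∀ j, a * p j = 0) → a * e = 0) ∧
      IsStarSup (Set.range fun F : Finset J => ∑ j ∈ F, p j) e := by
  classical
  set P : Finset J → A := fun F => ∑ j ∈ F, p j with hP
  have hproj := r.isStarProjection_op_sum hp hpp ho
  let U : Ultrafilter (Finset J) := Ultrafilter.of atTop
  have hU : (U : Filter (Finset J)) ≤ atTop := Ultrafilter.of_le atTop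
  obtain ⟨T, hT⟩ := exists_weak_limit U (fun F => r.op (P F)) 1 fun F => (hproj F).norm_le
  obtain ⟨e, rfl⟩ := r.exists_op_eq (mem_of_weak_limit r.S U (fun F => r.op_mem (P F)) hT)
  have hPs : ∀ F, star (P F) = P F := fun F => by simp [hP, star_sum, hp]
  have hes : star e = e := r.op_injective <| by
    rw [map_star]
    ext h
    refine ext_inner_right ℂ fun k => ?_
    rw [ContinuousLinearMap.star_eq_adjoint, ContinuousLinearMap.adjoint_inner_left]
    refine tendsto_nhds_unique ?_ (hT h k)
    have h1 := (Complex.continuous_conj.tendsto _).comp (hT k h)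
    rw [inner_conj_symm] at h1
    refine h1.congr fun F => ?_
    rw [Function.comp_apply, inner_conj_symm]
    exact ((hproj F).isSelfAdjoint.isSymmetric h k).symm
  have hmul : ∀ a b, (∀ᶠ F in (U : Filter (Finset J)), a * P F = b) → a * e = b := by
    intro a b hab
    apply r.op_injective
    rw [map_mul]
    ext h
    refine ext_inner_right ℂ fun k => ?_
    have h1 := hT h (ContinuousLinearMap.adjoint (r.op a) k)
    simp only [ContinuousLinearMap.adjoint_inner_right] at h1
    refine tendsto_nhds_unique h1 (tendsto_const_nhds.congr' ?_)
    filter_upwards [hab] with F hF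
    rw [← hF, map_mul]
    rfl
  have hPp : ∀ F, ∀ j ∈ F, p j * P F = p j := fun F j hj => by
    rw [hP, Finset.mul_sum, Finset.sum_eq_single_of_mem j hj fun k _ hk => ho j k hk.symm, hpp]
  have hpe : ∀ j, p j * e = p j := fun j => hmul _ _ <| by
    filter_upwards [hU (eventually_ge_atTop {j})] with F hF
    exact hPp F j (Finset.singleton_subset_iff.mp hF)
  have hep : ∀ j, e * p j = p j := fun j => by
    have h1 := congrArg star (hpe j)
    rwa [star_mul, hes, hp] at h1
  have hann : ∀ a, (∀ j, a * p j = 0) → a * e = 0 := fun a ha =>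
    hmul _ _ (Eventually.of_forall fun F => by simp [hP, Finset.mul_sum, ha])
  have hee : e * e = e := by
    have h1 := hann (1 - e) fun j => by rw [sub_mul, one_mul, hep, sub_self]
    rw [sub_mul, one_mul, sub_eq_zero] at h1
    exact h1.symm
  have hPe : ∀ F, P F * e = P F := fun F => by
    rw [hP, Finset.sum_mul]; exact Finset.sum_congr rfl fun j _ => hpe j
  have heP : ∀ F, e * P F = P F := fun F => by
    rw [hP, Finset.mul_sum]; exact Finset.sum_congr rfl fun j _ => hep j
  have hPP : ∀ F, P F * P F = P F := fun F => r.op_injective (by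
    rw [map_mul]; exact (hproj F).isIdempotentElem.eq)
  refine ⟨e, hes, hee, hep, hann, ?_, ?_⟩
  · rintro _ ⟨F, rfl⟩
    refine AddSubmonoid.subset_closure ⟨e - P F, ?_⟩
    change star (e - P F) * (e - P F) = e - P F
    rw [star_sub, hes, hPs, sub_mul, mul_sub, mul_sub, hee, heP, hPe, hPP]
    abel
  · intro b hb
    have hbP : ∀ F, r.op (P F) ≤ r.op b := fun F => r.starLE_iff.mp (hb _ ⟨F, rfl⟩)
    have hb0 : 0 ≤ r.op b := by simpa [hP] using hbP ∅
    have hbs : IsSelfAdjoint (r.op b) := IsSelfAdjoint.of_nonneg hb0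
    have hesa : IsSelfAdjoint (r.op e) := by rw [IsSelfAdjoint, ← map_star, hes]
    rw [r.starLE_iff, ContinuousLinearMap.le_def]
    refine ⟨(hbs.sub hesa).isSymmetric, fun h => ?_⟩
    have h1 := (Complex.continuous_re.tendsto _).comp
      ((tendsto_const_nhds (x := Inner.inner ℂ (r.op b h) h)).sub (hT h h))
    refine ge_of_tendsto
      (f := fun F => (Inner.inner ℂ (r.op b h) h - Inner.inner ℂ (r.op (P F) h) h).re)
      (x := (U : Filter (Finset J))) ?_ (Eventually.of_forall fun F => ?_)
    · simpa [ContinuousLinearMap.reApplyInnerSelf_apply, inner_sub_left, Function.comp_def] using h1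
    · have h2 := ((ContinuousLinearMap.le_def _ _).mp (hbP F)).2 h
      simpa [ContinuousLinearMap.reApplyInnerSelf_apply, inner_sub_left] using h2

open Filter Topology in
/-- A bounded family of elements `t j = q j * t j * p j`, for orthogonal projections `p j` and
orthogonal projections `q j`, can be summed: a weak limit of the partial sums restricts to `t j` on
`p j`. -/
theorem exists_sum_of_bounded {J : Type*} {p q : J → A} (hp : ∀ j, star (p j) = p j)
    (hpp : ∀ j, p j * p j = p j) (ho : ∀ j k, j ≠ k → p j * p k = 0)
    (hq : ∀ j, star (q j) = q j) (hqo : ∀ j k, j ≠ k → q j * q k = 0)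
    {t : J → A} (htp : ∀ j, t j * p j = t j) (hqt : ∀ j, q j * t j = t j) {K : ℝ}
    (hK : ∀ j, r.norm (t j) ≤ K) : ∃ s, ∀ j, s * p j = t j := by
  classical
  set P : Finset J → A := fun F => ∑ j ∈ F, t j with hP
  have hproj := r.isStarProjection_op_sum hp hpp ho
  have hbound : ∀ F, ‖r.op (P F)‖ ≤ |K| := by
    intro F
    -- The partial sums satisfy `(∑ t j)* (∑ t j) = ∑ (t j)* t j ≤ K² ∑ p j ≤ K²`.
    have h1 : star (P F) * P F = ∑ j ∈ F, star (t j) * t j := by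
      rw [hP, star_sum, Finset.sum_mul_sum]
      refine Finset.sum_congr rfl fun j hj => Finset.sum_eq_single_of_mem j hj fun k _ hk => ?_
      rw [← hqt j, ← hqt k, star_mul, hq, mul_assoc, ← mul_assoc (q j), hqo j k hk.symm, zero_mul,
        mul_zero]
    have h2 : ∀ j, r.op (star (t j) * t j) ≤ (K ^ 2) • r.op (p j) := by
      intro j
      have h3 : star (r.op (t j)) * r.op (t j) ≤ algebraMap ℝ _ (K ^ 2) := by
        refine (CStarAlgebra.star_mul_le_algebraMap_norm_sq).trans ?_
        rw [Algebra.algebraMap_eq_smul_one, Algebra.algebraMap_eq_smul_one]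
        exact smul_le_smul_of_nonneg_right
          (pow_le_pow_left₀ (_root_.norm_nonneg _) (hK j) 2) zero_le_one
      have h4 := star_left_conjugate_le_conjugate h3 (r.op (p j))
      rw [← map_star, ← map_star, hp, ← map_mul, ← map_mul, ← map_mul, mul_assoc, mul_assoc, htp,
        ← mul_assoc, ← hp j, ← star_mul, htp, hp, Algebra.algebraMap_eq_smul_one,
        mul_smul_comm, mul_one, smul_mul_assoc, ← map_mul, hpp] at h4
      exact h4
    have h3 : r.op (star (P F) * P F) ≤ (K ^ 2) • (1 : r.H →L[ℂ] r.H) := by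
      rw [h1, map_sum]
      refine (Finset.sum_le_sum fun j _ => h2 j).trans ?_
      rw [← Finset.smul_sum, ← map_sum]
      exact smul_le_smul_of_nonneg_left (hproj F).le_one (sq_nonneg K)
    have h4 := CStarAlgebra.norm_le_norm_of_nonneg_of_le
      (by rw [map_mul, map_star]; exact star_mul_self_nonneg _) h3
    rw [map_mul, map_star, CStarRing.norm_star_mul_self] at h4
    have h5 : ‖(K ^ 2) • (1 : r.H →L[ℂ] r.H)‖ ≤ K ^ 2 := by
      rw [_root_.norm_smul, Real.norm_of_nonneg (sq_nonneg K)]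
      exact mul_le_of_le_one_right (sq_nonneg K) ContinuousLinearMap.norm_id_le
    rw [← abs_of_nonneg (_root_.norm_nonneg (r.op (P F))), ← sq_le_sq, sq]
    exact h4.trans h5
  let U : Ultrafilter (Finset J) := Ultrafilter.of atTop
  have hU : (U : Filter (Finset J)) ≤ atTop := Ultrafilter.of_le atTop
  obtain ⟨T, hT⟩ := exists_weak_limit U (fun F => r.op (P F)) |K| hbound
  obtain ⟨s, rfl⟩ := r.exists_op_eq (mem_of_weak_limit r.S U (fun F => r.op_mem (P F)) hT)
  refine ⟨s, fun j => r.op_injective ?_⟩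
  rw [map_mul]
  ext h
  refine ext_inner_right ℂ fun k => ?_
  refine tendsto_nhds_unique (hT (r.op (p j) h) k) (tendsto_const_nhds.congr' ?_)
  filter_upwards [hU (eventually_ge_atTop {j})] with F hF
  have h1 : P F * p j = t j := by
    rw [hP, Finset.sum_mul, Finset.sum_eq_single_of_mem j (Finset.singleton_subset_iff.mp hF),
      htp]
    intro l _ hl
    rw [← htp l, mul_assoc, ho l j hl, mul_zero]
  rw [← h1, map_mul]
  rfl

end WStarRep

/-! ### Endomorphism algebras and positivity -/

section Positivity

variable {C : Type u} [Category.{v} C] [Preadditive C] [Linear ℂ C] [StarCategory C]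

theorem dag_neg {X Y : C} (f : X ⟶ Y) : dag (-f) = -dag f :=
  map_neg (AddMonoidHom.mk' (fun g : X ⟶ Y => dag g) (fun a b => dag_add a b)) f

theorem dag_sub {X Y : C} (f g : X ⟶ Y) : dag (f - g) = dag f - dag g := by
  rw [sub_eq_add_neg, dag_add, dag_neg, ← sub_eq_add_neg]

/-- Endomorphisms are one-by-one matrices. -/
def oneEquiv (c : C) : End c ≃⋆ₐ[ℂ] End (one c) where
  toFun f := toOne f
  invFun m := ofOne m
  left_inv _ := rfl
  right_inv _ := rfl
  map_mul' f g := by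
    refine Mat_.hom_ext _ _ fun i j => ?_
    exact (Fintype.sum_unique (fun _ : Unit => End.asHom g ≫ End.asHom f)).symm
  map_add' _ _ := rfl
  map_star' _ := rfl
  map_smul' _ _ := rfl

theorem single_id_comp_single_id {Z : Mat_ C} (i : Z.ι) (b : Z ⟶ Z) :
    single i i (𝟙 (Z.X i)) ≫ b ≫ single i i (𝟙 (Z.X i)) = single i i (b i i) := by
  ext a k
  rw [Mat_.comp_apply]
  by_cases ha : a = i
  · subst ha
    rw [Finset.sum_eq_single a, single_self, Category.id_comp, Mat_.comp_apply]
    · by_cases hk : k = a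
      · subst hk
        rw [Finset.sum_eq_single k, single_self, single_self, Category.comp_id]
        · intro l _ hl
          rw [single_of_ne _ (by tauto), Limits.comp_zero]
        · simp
      · rw [single_of_ne (i := a) (j := a) (b a a) (by tauto)]
        refine Finset.sum_eq_zero fun l _ => ?_
        rw [single_of_ne _ (by tauto), Limits.comp_zero]
    · intro l _ hl
      rw [single_of_ne _ (by tauto), Limits.zero_comp]
    · simp
  · rw [single_of_ne (b i i) (by tauto)]
    refine Finset.sum_eq_zero fun l _ => ?_
    rw [single_of_ne _ (by tauto), Limits.zero_comp]

variable [WStarCategory C]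

/-- A realisation of the endomorphism algebra of an object. -/
def endRep (c : C) : WStarRep (End c) :=
  { H := (matRep (one c)).H
    S := (matRep (one c)).S
    iso := (oneEquiv c).trans (matRep (one c)).iso }

theorem eq_zero_of_comp_dag {c d : C} {f : c ⟶ d} (h : f ≫ dag f = 0) : f = 0 := by
  let Z := pair c d
  have h1 : star (entry Z true false f) * entry Z true false f = 0 := by
    rw [star_entry, entry_mul, h]
    exact map_zero (AddMonoidHom.mk' (entry Z true true) (entry_add Z true true))
  have h2 := (matRep Z).eq_zero_of_star_mul_self h1
  refine entry_injective Z true false (h2.trans ?_)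
  exact (map_zero (AddMonoidHom.mk' (entry Z true false) (entry_add Z true false))).symm

/-- For a morphism `f : c ⟶ d`, the element `f f*` is positive in the corner `End c` of
`End (c ⊕ d)`. -/
theorem comp_dag_mem_posCone {c d : C} (f : c ⟶ d) : End.of (f ≫ dag f) ∈ posCone (End c) := by
  let Z := pair c d
  let m := entry Z true true (f ≫ dag f)
  let P := entry Z true true (𝟙 c)
  have hm : m ∈ posCone (End Z) := AddSubmonoid.subset_closure ⟨entry Z true false f, by
    change star _ * _ = m
    rw [star_entry, entry_mul]⟩
  have hPs : star P = P := by
    change star (entry Z true true (𝟙 c)) = _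
    rw [star_entry]
    exact congrArg (entry Z true true) (dag_id c)
  have hmP : m * P = m := by
    change entry Z true true _ * entry Z true true _ = _
    rw [entry_mul]
    exact congrArg (entry Z true true) (Category.id_comp _)
  obtain ⟨b, hbs, hb⟩ := (matRep Z).exists_mul_self_of_mem_posCone hm
  -- The square root of `m` lies in the corner cut out by `P`.
  have hbP : b * P = b := by
    have h : b * (1 - P) = 0 := by
      refine (matRep Z).eq_zero_of_star_mul_self ?_
      rw [star_mul, hbs, mul_assoc, ← mul_assoc b b, hb, mul_sub, mul_one, hmP, sub_self, mul_zero]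
    rw [mul_sub, mul_one, sub_eq_zero] at h
    exact h.symm
  have hPb : P * b = b := by
    have h := congrArg star hbP
    rwa [star_mul, hPs, hbs] at h
  let b' : c ⟶ c := (End.asHom b) true true
  have hb' : entry Z true true b' = b := by
    rw [← hPb, ← hbP, ← mul_assoc]
    exact (single_id_comp_single_id true (End.asHom b)).symm
  refine AddSubmonoid.subset_closure ⟨End.of b', ?_⟩
  have h1 : dag b' = b' := by
    apply entry_injective Z true true
    rw [← star_entry, hb', hbs]
  change b' ≫ dag b' = f ≫ dag f
  apply entry_injective Z true true
  rw [h1, ← entry_mul, hb']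
  exact hb

end Positivity

/-! ### Orthogonal direct sums -/

section DirectSums

variable {C : Type u} [Category.{v} C] [Preadditive C] [Linear ℂ C] [StarCategory C]

theorem star_rangeEnd {c x : C} (ι : c ⟶ x) : star (rangeEnd ι) = rangeEnd ι := by
  change dag (dag ι ≫ ι) = dag ι ≫ ι
  rw [dag_comp, dag_dag]

theorem rangeEnd_mul {c d x : C} (ι : c ⟶ x) (κ : d ⟶ x) :
    rangeEnd ι * rangeEnd κ = End.of (dag κ ≫ (κ ≫ dag ι) ≫ ι) := by
  change (dag κ ≫ κ) ≫ dag ι ≫ ι = _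
  simp only [Category.assoc]

theorem rangeEnd_mul_self {c x : C} {ι : c ⟶ x} (h : ι ≫ dag ι = 𝟙 c) :
    rangeEnd ι * rangeEnd ι = rangeEnd ι := by
  rw [rangeEnd_mul, h, Category.id_comp]
  rfl

theorem rangeEnd_mul_of_orthogonal {c d x : C} {ι : c ⟶ x} {κ : d ⟶ x} (h : κ ≫ dag ι = 0) :
    rangeEnd ι * rangeEnd κ = 0 := by
  rw [rangeEnd_mul, h, Limits.zero_comp, Limits.comp_zero]

variable [WStarCategory C]

/-- The inclusions of an orthogonal direct sum are jointly epimorphic. -/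
theorem IsOrthogonalDirectSum.eq_zero {J : Type w} {c : J → C} {x y : C} {ι : ∀ j, c j ⟶ x}
    (h : IsOrthogonalDirectSum ι) {f : x ⟶ y} (hf : ∀ j, ι j ≫ f = 0) : f = 0 := by
  refine eq_zero_of_comp_dag ((endRep x).eq_zero_of_isStarSup (p := fun j => rangeEnd (ι j))
    (fun j => star_rangeEnd _) (fun j => rangeEnd_mul_self (h.isometry j))
    (fun j k hjk => rangeEnd_mul_of_orthogonal (h.orthogonal k j hjk.symm)) h.sum_eq
    (comp_dag_mem_posCone f) fun j => ?_)
  change (dag (ι j) ≫ ι j) ≫ f ≫ dag f = 0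
  rw [Category.assoc, ← Category.assoc (ι j), hf, Limits.zero_comp, Limits.comp_zero]

theorem IsOrthogonalDirectSum.hom_ext {J : Type w} {c : J → C} {x y : C} {ι : ∀ j, c j ⟶ x}
    (h : IsOrthogonalDirectSum ι) {f g : x ⟶ y} (hf : ∀ j, ι j ≫ f = ι j ≫ g) : f = g :=
  sub_eq_zero.mp (h.eq_zero fun j => by rw [Preadditive.comp_sub, hf, sub_self])

theorem IsOrthogonalDirectSum.hom_ext_dag {J : Type w} {c : J → C} {x y : C} {ι : ∀ j, c j ⟶ x}
    (h : IsOrthogonalDirectSum ι) {f g : y ⟶ x} (hf : ∀ j, f ≫ dag (ι j) = g ≫ dag (ι j)) :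
    f = g := by
  have h1 : dag f = dag g := h.hom_ext fun j => by
    have := congrArg dag (hf j)
    rwa [dag_comp, dag_comp, dag_dag] at this
  rw [← dag_dag f, h1, dag_dag]

/-- An orthogonal family of isometries has a supremum of its ranges, which is the smallest
projection through which the family factors. -/
theorem exists_range_projection {J : Type w} {c : J → C} {x : C} {ι : ∀ j, c j ⟶ x}
    (h1 : ∀ j, ι j ≫ dag (ι j) = 𝟙 (c j)) (h2 : ∀ j k, j ≠ k → ι j ≫ dag (ι k) = 0) :
    ∃ e : x ⟶ x, dag e = e ∧ e ≫ e = e ∧ (∀ j, ι j ≫ e = ι j) ∧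
      (∀ (y : C) (f : x ⟶ y), (∀ j, ι j ≫ f = 0) → e ≫ f = 0) ∧
      IsStarSup (Set.range fun F : Finset J => ∑ j ∈ F, rangeEnd (ι j)) (End.of e) := by
  obtain ⟨e, hes, hee, hep, hann, hsup⟩ := (endRep x).exists_isStarSup_sum
    (p := fun j => rangeEnd (ι j)) (fun j => star_rangeEnd _) (fun j => rangeEnd_mul_self (h1 j))
    (fun j k hjk => rangeEnd_mul_of_orthogonal (h2 k j hjk.symm))
  have hes' : dag (End.asHom e) = End.asHom e := hes
  refine ⟨End.asHom e, hes', hee, fun j => ?_, fun y f hf => ?_, hsup⟩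
  · have h : (dag (ι j) ≫ ι j) ≫ End.asHom e = dag (ι j) ≫ ι j := hep j
    have := congrArg (fun t => ι j ≫ t) h
    simpa only [← Category.assoc, h1, Category.id_comp] using this
  · have h : End.asHom e ≫ f ≫ dag f = 0 := hann (End.of (f ≫ dag f)) fun j => by
      change (dag (ι j) ≫ ι j) ≫ f ≫ dag f = 0
      rw [Category.assoc, ← Category.assoc (ι j), hf, Limits.zero_comp, Limits.comp_zero]
    refine eq_zero_of_comp_dag ?_
    rw [dag_comp, Category.assoc, ← Category.assoc f, ← Category.assoc, h, Limits.zero_comp]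

theorem isOrthogonalDirectSum_of_eq_zero {J : Type w} {c : J → C} {x : C} {ι : ∀ j, c j ⟶ x}
    (h1 : ∀ j, ι j ≫ dag (ι j) = 𝟙 (c j)) (h2 : ∀ j k, j ≠ k → ι j ≫ dag (ι k) = 0)
    (h3 : ∀ f : x ⟶ x, (∀ j, ι j ≫ f = 0) → f = 0) : IsOrthogonalDirectSum ι := by
  obtain ⟨e, -, -, he, -, hsup⟩ := exists_range_projection h1 h2
  have h4 : 𝟙 x - e = 0 := h3 _ fun j => by
    rw [Preadditive.comp_sub, Category.comp_id, he, sub_self]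
  rw [← sub_eq_zero.mp h4] at hsup
  exact ⟨h1, h2, hsup⟩

end DirectSums

/-! ### The part of an object generated by a family -/

section Support

variable {C : Type u} [Category.{v} C] [Preadditive C] [Linear ℂ C] [StarCategory C]

/-- The morphisms from the objects `c j` to `x` are jointly epimorphic. -/
def IsTotalFor {J : Type w} (c : J → C) : ObjectProperty C := fun x =>
  ∀ ⦃y : C⦄ (f : x ⟶ y), (∀ j (g : c j ⟶ x), g ≫ f = 0) → f = 0

/-- `e` is the projection onto the part of `x` which is generated by the objects `c j`: the smallest
projection of `x` through which all morphisms from the `c j` factor. -/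
structure IsSupport {J : Type w} (c : J → C) {x : C} (e : x ⟶ x) : Prop where
  dag_eq : dag e = e
  comp_self : e ≫ e = e
  comp_eq : ∀ j (g : c j ⟶ x), g ≫ e = g
  comp_eq_zero : ∀ ⦃y : C⦄ (f : x ⟶ y), (∀ j (g : c j ⟶ x), g ≫ f = 0) → e ≫ f = 0

variable [WStarCategory C]

/-- If there is a nonzero morphism `f : s ⟶ x`, then `s` and `x` have a nonzero subobject `z` in
common, whose inclusion `v ≫ f` into `x` factors through `f`. -/
theorem exists_isometry_factor (hI : IsIdempotentCompleteStar C) {s x : C} {f : s ⟶ x}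
    (hf : f ≠ 0) : ∃ (z : C) (σ : z ⟶ s) (v : z ⟶ s),
      𝟙 z ≠ 0 ∧ σ ≫ dag σ = 𝟙 z ∧ (v ≫ f) ≫ dag (v ≫ f) = 𝟙 z := by
  obtain ⟨p, w, hp0, hpp, hps, hw⟩ := (endRep s).exists_projection_of_pos
    (comp_dag_mem_posCone f) fun h => hf (eq_zero_of_comp_dag h)
  obtain ⟨z, σ, h1, h2⟩ := hI s (End.asHom p) hpp hps
  refine ⟨z, σ, σ ≫ dag (End.asHom w), fun h => hp0 ?_, h2, ?_⟩
  · change End.asHom p = 0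
    rw [← h1, ← Category.id_comp σ, h, Limits.zero_comp, Limits.comp_zero]
  · have h3 : dag (End.asHom w) ≫ (f ≫ dag f) ≫ End.asHom w = End.asHom p := hw
    have h4 : ((σ ≫ dag (End.asHom w)) ≫ f) ≫ dag ((σ ≫ dag (End.asHom w)) ≫ f) =
        σ ≫ (dag (End.asHom w) ≫ (f ≫ dag f) ≫ End.asHom w) ≫ dag σ := by
      simp only [dag_comp, dag_dag, Category.assoc]
    rw [h4, h3, ← h1]
    simp only [← Category.assoc, h2, Category.id_comp]

/-- The part of `x` generated by `s` is an orthogonal direct sum of subobjects of `s`. A maximal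
orthogonal family of subobjects of `x` which are isomorphic to subobjects of `s` exhausts it, by
`exists_isometry_factor`. -/
theorem exists_maximal_isometries (hI : IsIdempotentCompleteStar C) (s x : C) :
    ∃ (J : Type v) (z : J → C) (σ : ∀ j, z j ⟶ s) (ι : ∀ j, z j ⟶ x) (e : x ⟶ x),
      (∀ j, σ j ≫ dag (σ j) = 𝟙 (z j)) ∧ (∀ j, ι j ≫ dag (ι j) = 𝟙 (z j)) ∧
      (∀ j k, j ≠ k → ι j ≫ dag (ι k) = 0) ∧ dag e = e ∧ e ≫ e = e ∧ (∀ g : s ⟶ x, g ≫ e = g) ∧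
      ∀ (y : C) (f : x ⟶ y), (∀ j, ι j ≫ f = 0) → e ≫ f = 0 := by
  -- Subobjects of `x` are represented by their range projections, which form a set.
  let good : Set (x ⟶ x) := {q | ∃ (z : C) (σ : z ⟶ s) (ι : z ⟶ x),
    σ ≫ dag σ = 𝟙 z ∧ ι ≫ dag ι = 𝟙 z ∧ dag ι ≫ ι = q}
  obtain ⟨W, hW⟩ := zorn_subset {W : Set (x ⟶ x) | W ⊆ good ∧ W.Pairwise fun q q' => q ≫ q' = 0} (by
    intro Ch hCh hchain
    refine ⟨⋃₀ Ch, ⟨Set.sUnion_subset fun W hW => (hCh hW).1, ?_⟩, fun W hW =>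
      Set.subset_sUnion_of_mem hW⟩
    exact (Set.pairwise_sUnion hchain.directedOn).mpr fun W hW => (hCh hW).2)
  choose z σ ι h1 h2 h3 using fun q : W => hW.prop.1 q.2
  have h4 : ∀ j k, j ≠ k → ι j ≫ dag (ι k) = 0 := by
    intro j k hjk
    have h : (dag (ι j) ≫ ι j) ≫ dag (ι k) ≫ ι k = 0 := by
      rw [h3, h3]
      exact hW.prop.2 j.2 k.2 fun h => hjk (Subtype.ext h)
    have h' := congrArg (fun t => ι j ≫ t ≫ dag (ι k)) h
    simp only [Category.assoc, h2, Category.comp_id, Limits.zero_comp, Limits.comp_zero] at h'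
    rwa [← Category.assoc, h2, Category.id_comp] at h'
  obtain ⟨e, hes, hee, he, hann, -⟩ := exists_range_projection h2 h4
  refine ⟨W, z, σ, ι, e, h1, h2, h4, hes, hee, fun g => ?_, hann⟩
  by_contra hg
  have hf : g ≫ (𝟙 x - e) ≠ 0 := fun h => hg (by
    rw [Preadditive.comp_sub, Category.comp_id, sub_eq_zero] at h
    exact h.symm)
  obtain ⟨z', σ', v, hz', hσ', hv⟩ := exists_isometry_factor hI hf
  set κ := v ≫ g ≫ (𝟙 x - e) with hκ
  have hκe : κ ≫ e = 0 := by
    simp only [hκ, Category.assoc, Preadditive.sub_comp, Category.id_comp, hee, sub_self,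
      Limits.comp_zero]
  have heκ : e ≫ dag κ = 0 := by
    rw [← hes, ← dag_comp, hκe, dag_zero]
  have hq : ∀ q ∈ W, (dag κ ≫ κ) ≫ q = 0 ∧ q ≫ dag κ ≫ κ = 0 := by
    intro q hqW
    have h3' : dag (ι ⟨q, hqW⟩) ≫ ι ⟨q, hqW⟩ = q := h3 ⟨q, hqW⟩
    have hqe : q ≫ e = q := by
      rw [← h3', Category.assoc, he]
    have heq : e ≫ q = q := by
      rw [← h3', ← Category.assoc]
      have := congrArg dag (he ⟨q, hqW⟩)
      rw [dag_comp, hes] at this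
      rw [this]
    constructor
    · rw [← heq, Category.assoc, ← Category.assoc κ, hκe, Limits.zero_comp, Limits.comp_zero]
    · rw [← hqe, Category.assoc, ← Category.assoc e, heκ, Limits.zero_comp, Limits.comp_zero]
  have hmem : dag κ ≫ κ ∈ W := by
    refine hW.le_of_ge (y := insert (dag κ ≫ κ) W) ⟨?_, ?_⟩ (Set.subset_insert _ _)
      (Set.mem_insert _ _)
    · exact Set.insert_subset ⟨z', σ', κ, hσ', hv, rfl⟩ hW.prop.1
    · exact hW.prop.2.insert fun q hqW _ => hq q hqW
  have h0 := (hq _ hmem).1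
  -- The identity `(κ* κ) (κ* κ) = 0` is compressed to `𝟙 z' = 0`.
  have h5 := congrArg (fun t => κ ≫ t ≫ dag κ) h0
  simp only [Category.assoc, hv, Category.comp_id, Limits.zero_comp, Limits.comp_zero] at h5
  exact hz' h5

/-- An object belongs to the full subcategory generated by a family precisely if the morphisms from
the members of the family are jointly epimorphic. -/
theorem generatedByFamily_iff (hC : IsCauchyComplete C) {J : Type v} (c : J → C) (x : C) :
    generatedByFamily c x ↔ IsTotalFor c x := by
  constructor
  · rintro ⟨s, κ, hκ, K, p, z, σ, y, ι, hσ, hι, ⟨i⟩⟩ t f hf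
    have h : i.inv ≫ f = 0 := by
      refine hι.eq_zero fun k => ?_
      have h1 : dag (σ k) ≫ ι k ≫ i.inv ≫ f = 0 := hκ.eq_zero fun j => by
        have := hf j (κ j ≫ dag (σ k) ≫ ι k ≫ i.inv)
        simpa only [Category.assoc] using this
      have h2 := congrArg (fun t => σ k ≫ t) h1
      simpa only [← Category.assoc, (hσ k).2, Category.id_comp, Limits.comp_zero] using h2
    rw [← Category.id_comp f, ← i.hom_inv_id, Category.assoc, h, Limits.comp_zero]
  · intro hx
    obtain ⟨s, κ, hκ⟩ := hC.1 J c
    obtain ⟨K, z, σ, ι, e, h1, h2, h3, -, -, h4, h5⟩ := exists_maximal_isometries hC.2 s x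
    refine ⟨s, κ, hκ, K, fun k => dag (σ k) ≫ σ k, z, σ, x, ι, fun k => ⟨rfl, h1 k⟩,
      isOrthogonalDirectSum_of_eq_zero h2 h3 fun f hf => ?_, ⟨Iso.refl x⟩⟩
    have he : 𝟙 x - e = 0 := hx _ fun j g => by
      have h6 : g ≫ e = g := by
        have := congrArg (fun t => κ j ≫ t) (h4 (dag (κ j) ≫ g))
        simpa only [← Category.assoc, hκ.isometry, Category.id_comp] using this
      rw [Preadditive.comp_sub, Category.comp_id, h6, sub_self]
    rw [← Category.id_comp f, sub_eq_zero.mp he]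
    exact h5 x f hf

theorem exists_isSupport (hC : IsCauchyComplete C) {J : Type v} (c : J → C) (x : C) :
    ∃ e : x ⟶ x, IsSupport c e := by
  obtain ⟨s, κ, hκ⟩ := hC.1 J c
  obtain ⟨K, z, σ, ι, e, h1, -, -, h2, h3, h4, h5⟩ := exists_maximal_isometries hC.2 s x
  refine ⟨e, h2, h3, fun j g => ?_, fun y f hf => h5 y f fun k => ?_⟩
  · have := congrArg (fun t => κ j ≫ t) (h4 (dag (κ j) ≫ g))
    simpa only [← Category.assoc, hκ.isometry, Category.id_comp] using this
  · have h6 : dag (σ k) ≫ ι k ≫ f = 0 := hκ.eq_zero fun j => by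
      have := hf j (κ j ≫ dag (σ k) ≫ ι k)
      simpa only [Category.assoc] using this
    have h7 := congrArg (fun t => σ k ≫ t) h6
    simpa only [← Category.assoc, h1, Category.id_comp, Limits.comp_zero] using h7

end Support

/-! ### Norms of morphisms -/

section Norms

variable {C : Type u} [Category.{v} C] [Preadditive C] [Linear ℂ C] [StarCategory C]

theorem fullSubEnd_entry {P : ObjectProperty C} (Z : Mat_ P.FullSubcategory) (i j : Z.ι)
    (f : Z.X i ⟶ Z.X j) : fullSubEnd Z (entry Z i j f) = entry (fullSubMat Z) i j f.hom := by
  refine Mat_.hom_ext _ _ fun a b => ?_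
  change (single i j f a b).hom = single (Z := fullSubMat Z) i j f.hom a b
  by_cases h : a = i ∧ b = j
  · obtain ⟨rfl, rfl⟩ := h
    rw [single_self, single_self]
  · have h1 : single i j f a b = 0 := single_of_ne f h
    have h2 : single (Z := fullSubMat Z) i j f.hom a b = 0 := single_of_ne (Z := fullSubMat Z) _ h
    exact (congrArg (fun t => t.hom) h1).trans h2.symm

theorem single_comp_apply {Z : Mat_ C} (i j k : Z.ι) (f : Z.X i ⟶ Z.X j) (b : Z ⟶ Z) :
    (single i j f ≫ b) i k = f ≫ b j k := by
  rw [Mat_.comp_apply, Finset.sum_eq_single j, single_self]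
  · intro l _ hl
    rw [single_of_ne _ (by tauto), Limits.zero_comp]
  · simp

variable [WStarCategory C]

theorem homNorm_hom {P : ObjectProperty C} {X Y : P.FullSubcategory} (f : X ⟶ Y) :
    homNorm f.hom = homNorm f := by
  let Z := pair X Y
  let r : WStarRep (End Z) :=
    { H := (matRep (fullSubMat Z)).H
      S := (matRep (fullSubMat Z)).S
      iso := (fullSubEnd Z).trans (matRep (fullSubMat Z)).iso }
  have h1 : homNorm f = r.norm (entry Z true false f) := homNorm_eq Z r true false f
  have h2 : homNorm f.hom = (matRep (fullSubMat Z)).norm (entry (fullSubMat Z) true false f.hom) :=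
    homNorm_eq (fullSubMat Z) (matRep (fullSubMat Z)) true false f.hom
  rw [h1, h2]
  have h3 := fullSubEnd_entry Z true false f
  exact congrArg (matRep (fullSubMat Z)).norm h3.symm

theorem homNorm_le_one_of_isometry {c d : C} {f : c ⟶ d} (h : f ≫ dag f = 𝟙 c) :
    homNorm f ≤ 1 := by
  have h1 : homNorm f * homNorm f = (matRep (one c)).norm (toOne (f ≫ dag f)) :=
    norm_entry_sq (pair c d) (matRep _) true false f
  have h2 : homNorm (𝟙 c) * homNorm (𝟙 c) = (matRep (one c)).norm (toOne (𝟙 c ≫ dag (𝟙 c))) :=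
    norm_entry_sq (pair c c) (matRep _) true false (𝟙 c)
  rw [h, ← show 𝟙 c ≫ dag (𝟙 c) = 𝟙 c by simp, ← h2] at h1
  nlinarith [homNorm_nonneg f, homNorm_id_le c, homNorm_nonneg (𝟙 c)]

theorem homNorm_compress_le {a b x y : C} {ι : a ⟶ x} {κ : b ⟶ y} (hι : ι ≫ dag ι = 𝟙 a)
    (hκ : κ ≫ dag κ = 𝟙 b) (f : x ⟶ y) : homNorm (ι ≫ f ≫ dag κ) ≤ homNorm f := by
  have h1 := homNorm_le_one_of_isometry hι
  have h2 := homNorm_le_one_of_isometry hκ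
  rw [← homNorm_dag] at h2
  calc homNorm (ι ≫ f ≫ dag κ) ≤ homNorm ι * (homNorm f * homNorm (dag κ)) :=
        (homNorm_comp_le _ _).trans
          (mul_le_mul_of_nonneg_left (homNorm_comp_le _ _) (homNorm_nonneg _))
    _ ≤ 1 * (homNorm f * 1) := mul_le_mul h1
        (mul_le_mul_of_nonneg_left h2 (homNorm_nonneg _))
        (mul_nonneg (homNorm_nonneg _) (homNorm_nonneg _)) zero_le_one
    _ = homNorm f := by ring

/-- Bounded families of morphisms between the summands of two orthogonal direct sums are
the diagonals of morphisms between the direct sums. -/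
theorem exists_hom_of_bounded {J : Type w} {a b : J → C} {x y : C} {ι : ∀ j, a j ⟶ x}
    {κ : ∀ j, b j ⟶ y} (hι : IsOrthogonalDirectSum ι) (hκ : IsOrthogonalDirectSum κ)
    (f : ∀ j, a j ⟶ b j) {K : ℝ} (hK : ∀ j, homNorm (f j) ≤ K) :
    ∃ g : x ⟶ y, ∀ j, ι j ≫ g ≫ dag (κ j) = f j := by
  let Z := pair x y
  have hmul : ∀ {i j k : Z.ι} (f : Z.X i ⟶ Z.X j) (g : Z.X j ⟶ Z.X k),
    entry Z j k g * entry Z i j f = entry Z i k (f ≫ g) := fun f g => entry_mul Z _ _ _ f g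
  have hzero : ∀ i j, entry Z i j 0 = 0 := fun i j =>
    map_zero (AddMonoidHom.mk' (entry Z i j) (entry_add Z i j))
  obtain ⟨s, hs⟩ := (matRep Z).exists_sum_of_bounded
    (p := fun j => entry Z true true (rangeEnd (ι j)))
    (q := fun j => entry Z false false (rangeEnd (κ j)))
    (t := fun j => entry Z true false (dag (ι j) ≫ f j ≫ κ j)) (K := K)
    (fun j => by
      rw [star_entry]; exact congrArg _ (star_rangeEnd (ι j)))
    (fun j => by
      rw [hmul]; exact congrArg (entry Z true true) (rangeEnd_mul_self (hι.isometry j)))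
    (fun j k hjk => by
      rw [hmul, ← hzero]
      exact congrArg (entry Z true true)
        (rangeEnd_mul_of_orthogonal (hι.orthogonal k j hjk.symm)))
    (fun j => by
      rw [star_entry]; exact congrArg _ (star_rangeEnd (κ j)))
    (fun j k hjk => by
      rw [hmul, ← hzero]
      exact congrArg (entry Z false false)
        (rangeEnd_mul_of_orthogonal (hκ.orthogonal k j hjk.symm)))
    (fun j => by
      rw [hmul]
      refine congrArg (entry Z true false) ?_
      change (dag (ι j) ≫ ι j) ≫ dag (ι j) ≫ f j ≫ κ j = _
      rw [Category.assoc, ← Category.assoc (ι j), hι.isometry, Category.id_comp])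
    (fun j => by
      rw [hmul]
      refine congrArg (entry Z true false) ?_
      change (dag (ι j) ≫ f j ≫ κ j) ≫ dag (κ j) ≫ κ j = _
      simp only [Category.assoc]
      rw [← Category.assoc (κ j), hκ.isometry, Category.id_comp])
    (fun j => by
      have h1 := homNorm_eq Z (matRep Z) true false (dag (ι j) ≫ f j ≫ κ j)
      have h2 := homNorm_le_one_of_isometry (hι.isometry j)
      have h3 := homNorm_le_one_of_isometry (hκ.isometry j)
      rw [← homNorm_dag] at h2
      refine h1.symm.le.trans ?_
      calc homNorm (dag (ι j) ≫ f j ≫ κ j)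
          ≤ homNorm (dag (ι j)) * (homNorm (f j) * homNorm (κ j)) :=
            (homNorm_comp_le _ _).trans
              (mul_le_mul_of_nonneg_left (homNorm_comp_le _ _) (homNorm_nonneg _))
        _ ≤ 1 * (homNorm (f j) * 1) := mul_le_mul h2
            (mul_le_mul_of_nonneg_left h3 (homNorm_nonneg _))
            (mul_nonneg (homNorm_nonneg _) (homNorm_nonneg _)) zero_le_one
        _ ≤ K := by simpa using hK j)
  let g : x ⟶ y := (End.asHom s) true false
  refine ⟨g, fun j => ?_⟩
  have h : (dag (ι j) ≫ ι j) ≫ g = dag (ι j) ≫ f j ≫ κ j := by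
    have h1 := single_comp_apply (Z := Z) true true false (rangeEnd (ι j)) (End.asHom s)
    have h2 : single (Z := Z) true true (rangeEnd (ι j)) ≫ End.asHom s =
      single (Z := Z) true false (dag (ι j) ≫ f j ≫ κ j) := hs j
    rw [h2, single_self] at h1
    exact h1.symm
  have h' := congrArg (fun t => ι j ≫ t ≫ dag (κ j)) h
  simp only [Category.assoc, hκ.isometry, Category.comp_id] at h'
  simpa only [← Category.assoc, hι.isometry, Category.id_comp] using h'

end Norms

/-! ### Normality of fully faithful `*`-functors -/

section Normal

theorem map_mem_posCone {A B : Type*} [Ring A] [StarRing A] [Ring B] [StarRing B] (φ : A →+* B)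
    (hφ : ∀ a, φ (star a) = star (φ a)) {a : A} (ha : a ∈ posCone A) : φ a ∈ posCone B := by
  induction ha using AddSubmonoid.closure_induction with
  | mem x hx =>
    obtain ⟨b, rfl⟩ := hx
    exact AddSubmonoid.subset_closure ⟨φ b, by simp [hφ]⟩
  | zero => rw [map_zero]; exact zero_mem _
  | add x y _ _ hx hy => rw [map_add]; exact add_mem hx hy

/-- Suprema only depend on the algebraic structure, so that `*`-isomorphisms are normal. -/
theorem isNormalMap_of_equiv {A B : Type*} [Ring A] [StarRing A] [Ring B] [StarRing B] (φ : A ≃+* B)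
    (hφ : ∀ a, φ (star a) = star (φ a)) : IsNormalMap φ := by
  have hle : ∀ a b, StarLE a b → StarLE (φ a) (φ b) := fun a b h => by
    have := map_mem_posCone φ.toRingHom hφ h
    rwa [map_sub] at this
  have hφ' : ∀ b, φ.symm (star b) = star (φ.symm b) := fun b => by
    rw [φ.symm_apply_eq, hφ, φ.apply_symm_apply]
  have hle' : ∀ a b, StarLE a b → StarLE (φ.symm a) (φ.symm b) := fun a b h => by
    have := map_mem_posCone φ.symm.toRingHom hφ' h
    rwa [map_sub] at this
  rintro D - - - s ⟨h1, h2⟩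
  constructor
  · rintro _ ⟨a, ha, rfl⟩
    exact hle _ _ (h1 a ha)
  · intro b hb
    have := hle _ _ (h2 (φ.symm b) fun a ha => by
      simpa using hle' _ _ (hb _ ⟨a, ha, rfl⟩))
    rwa [φ.apply_symm_apply] at this

variable {C : Type u} [Category.{v} C] [Preadditive C] [Linear ℂ C] [StarCategory C]
variable {D : Type u'} [Category.{w} D] [Preadditive D] [Linear ℂ D] [StarCategory D]

theorem isNormalMap_matEndMap (F : C ⥤ D) [F.Additive] [F.Full] [F.Faithful]
    (hF : ∀ {X Y : C} (f : X ⟶ Y), F.map (dag f) = dag (F.map f)) (X : Mat_ C) :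
    IsNormalMap (matEndMap F X) := by
  let φ : End X ≃+* End (matObj F X) :=
    { toFun := matEndMap F X
      invFun := fun m => End.of (fun i j => F.preimage ((End.asHom m) i j) : X ⟶ X)
      left_inv := fun m => by
        refine Mat_.hom_ext _ _ fun i j => ?_
        exact F.preimage_map _
      right_inv := fun m => by
        refine Mat_.hom_ext _ _ fun i j => ?_
        exact F.map_preimage _
      map_mul' := fun m n => by
        refine Mat_.hom_ext _ _ fun i j => ?_
        change F.map (∑ l, (End.asHom n) i l ≫ (End.asHom m) l j) = _
        rw [F.map_sum]
        simp only [F.map_comp]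
        rfl
      map_add' := fun m n => by
        refine Mat_.hom_ext _ _ fun i j => ?_
        exact F.map_add }
  refine isNormalMap_of_equiv φ fun m => ?_
  refine Mat_.hom_ext _ _ fun i j => ?_
  exact hF _

end Normal

/-! ### Splittings from pointwise decompositions -/

section Splitting

variable {C : Type u} [Category.{v} C] [Preadditive C] [Linear ℂ C] [StarCategory C]
  [WStarCategory C]

/-- A morphism into an orthogonal direct sum which is orthogonal to all summands but one factors
through that summand. -/
theorem IsOrthogonalDirectSum.comp_dag_comp {J : Type w} {c : J → C} {x w : C} {ι : ∀ j, c j ⟶ x}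
    (h : IsOrthogonalDirectSum ι) (i : J) {a : w ⟶ x} (ha : ∀ j, j ≠ i → a ≫ dag (ι j) = 0) :
    a ≫ dag (ι i) ≫ ι i = a := by
  refine h.hom_ext_dag fun j => ?_
  by_cases hj : j = i
  · subst hj
    simp only [Category.assoc, h.isometry, Category.comp_id]
  · simp only [Category.assoc, h.orthogonal i j (Ne.symm hj), Limits.comp_zero, ha j hj]

/-- Objectwise decompositions `x = ⊕ z x i` with `z x i ∈ D i`, for pairwise orthogonal full
subcategories `D i`. -/
structure ObjectwiseSplitting {I : Type w} (D : I → ObjectProperty C) where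
  obj : C → I → C
  mem : ∀ x i, D i (obj x i)
  incl : ∀ x i, obj x i ⟶ x
  isSum : ∀ x, IsOrthogonalDirectSum (incl x)
  orthogonal : ∀ i j, i ≠ j → ∀ a b, D i a → D j b → ∀ f : a ⟶ b, f = 0

namespace ObjectwiseSplitting

variable {I : Type w} {D : I → ObjectProperty C} (Z : ObjectwiseSplitting D)

/-- Morphisms are diagonal for the decompositions. -/
theorem incl_comp {x y : C} (f : x ⟶ y) (i : I) :
    (Z.incl x i ≫ f ≫ dag (Z.incl y i)) ≫ Z.incl y i = Z.incl x i ≫ f := by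
  have := (Z.isSum y).comp_dag_comp i (a := Z.incl x i ≫ f) fun j hj =>
    Z.orthogonal i j hj.symm _ _ (Z.mem x i) (Z.mem y j) _
  simpa only [Category.assoc] using this

/-- The functor `x ↦ (x_i)` which is defined by objectwise decompositions. -/
def functor : C ⥤ Boxplus (fun i => (D i).FullSubcategory) where
  obj x := ⟨fun i => ⟨Z.obj x i, Z.mem x i⟩⟩
  map {x y} f := ⟨fun i => ObjectProperty.homMk (Z.incl x i ≫ f ≫ dag (Z.incl y i)), homNorm f,
    fun i => (homNorm_hom _).symm.le.trans
      (homNorm_compress_le ((Z.isSum x).isometry i) ((Z.isSum y).isometry i) f)⟩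
  map_id x := Subtype.ext <| funext fun i => ObjectProperty.hom_ext _ <| by
    change Z.incl x i ≫ 𝟙 x ≫ dag (Z.incl x i) = 𝟙 _
    rw [Category.id_comp, (Z.isSum x).isometry]
  map_comp {x y w} f g := Subtype.ext <| funext fun i => ObjectProperty.hom_ext _ <| by
    change Z.incl x i ≫ (f ≫ g) ≫ dag (Z.incl w i) =
      (Z.incl x i ≫ f ≫ dag (Z.incl y i)) ≫ Z.incl y i ≫ g ≫ dag (Z.incl w i)
    rw [← Category.assoc _ (Z.incl y i), Z.incl_comp]
    simp only [Category.assoc]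

theorem functor_map_app {x y : C} (f : x ⟶ y) (i : I) :
    (Boxplus.app (Z.functor.map f) i).hom = Z.incl x i ≫ f ≫ dag (Z.incl y i) := rfl

theorem boxplus_hom_ext {X Y : Boxplus (fun i => (D i).FullSubcategory)} {f g : X ⟶ Y}
    (h : ∀ i, (Boxplus.app f i).hom = (Boxplus.app g i).hom) : f = g :=
  Subtype.ext <| funext fun i => ObjectProperty.hom_ext _ (h i)

instance : Z.functor.Faithful where
  map_injective {x y} f g h := (Z.isSum x).hom_ext fun i => by
    rw [← Z.incl_comp f, ← Z.incl_comp g, ← Z.functor_map_app, h, Z.functor_map_app]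

instance : Z.functor.Full where
  map_surjective {x y} φ := by
    obtain ⟨K, hK⟩ := φ.2
    obtain ⟨g, hg⟩ := exists_hom_of_bounded (Z.isSum x) (Z.isSum y) (fun i => (φ.1 i).hom)
      (K := K) fun i => (homNorm_hom _).le.trans (hK i)
    exact ⟨g, boxplus_hom_ext hg⟩

instance : Z.functor.Additive where
  map_add {x y f g} := boxplus_hom_ext fun i => by
    change Z.incl x i ≫ (f + g) ≫ dag (Z.incl y i) =
      Z.incl x i ≫ f ≫ dag (Z.incl y i) + Z.incl x i ≫ g ≫ dag (Z.incl y i)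
    rw [Preadditive.add_comp, Preadditive.comp_add]

theorem functor_map_dag {x y : C} (f : x ⟶ y) : Z.functor.map (dag f) = dag (Z.functor.map f) :=
  boxplus_hom_ext fun i => by
    change Z.incl y i ≫ dag f ≫ dag (Z.incl x i) = dag (Z.incl x i ≫ f ≫ dag (Z.incl y i))
    simp only [dag_comp, dag_dag, Category.assoc]

theorem isWStarFunctor_functor : IsWStarFunctor Z.functor where
  additive := inferInstance
  linear := ⟨fun {x y} f z => boxplus_hom_ext fun i => by
    change Z.incl x i ≫ (z • f) ≫ dag (Z.incl y i) = z • (Z.incl x i ≫ f ≫ dag (Z.incl y i))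
    rw [Linear.smul_comp, Linear.comp_smul]⟩
  map_dag := Z.functor_map_dag
  normal := isNormalMap_matEndMap Z.functor Z.functor_map_dag

theorem essSurj_functor (hsum : ∀ c : I → C, (∀ i, D i (c i)) →
    ∃ (x : C) (ι : ∀ i, c i ⟶ x), IsOrthogonalDirectSum ι) : Z.functor.EssSurj where
  mem_essImage Y := by
    obtain ⟨x, ι, hι⟩ := hsum (fun i => (Y.obj i).obj) fun i => (Y.obj i).property
    have h1 : ∀ i, Z.incl x i ≫ dag (ι i) ≫ ι i = Z.incl x i := fun i =>
      hι.comp_dag_comp i fun j hj =>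
        Z.orthogonal i j hj.symm _ _ (Z.mem x i) (Y.obj j).property _
    have h2 : ∀ i, ι i ≫ dag (Z.incl x i) ≫ Z.incl x i = ι i := fun i =>
      (Z.isSum x).comp_dag_comp i fun j hj =>
        Z.orthogonal i j hj.symm _ _ (Y.obj i).property (Z.mem x j) _
    have hb : ∀ i, homNorm (Z.incl x i ≫ dag (ι i)) ≤ 1 := fun i =>
      homNorm_le_one_of_isometry (by
        rw [dag_comp, dag_dag, Category.assoc, ← Category.assoc (dag (ι i)), ← Category.assoc, h1,
          (Z.isSum x).isometry])
    refine ⟨x, ⟨⟨⟨fun i => ObjectProperty.homMk (Z.incl x i ≫ dag (ι i)), 1, fun i =>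
        (homNorm_hom _).symm.le.trans (hb i)⟩,
      ⟨fun i => ObjectProperty.homMk (ι i ≫ dag (Z.incl x i)), 1, fun i =>
        (homNorm_hom _).symm.le.trans ?_⟩,
      boxplus_hom_ext fun i => ?_, boxplus_hom_ext fun i => ?_⟩⟩⟩
    · have h3 := hb i
      rw [← homNorm_dag, dag_comp, dag_dag] at h3
      exact h3
    · change (Z.incl x i ≫ dag (ι i)) ≫ ι i ≫ dag (Z.incl x i) = 𝟙 _
      rw [Category.assoc, ← Category.assoc (dag (ι i)), ← Category.assoc, h1,
        (Z.isSum x).isometry]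
    · change (ι i ≫ dag (Z.incl x i)) ≫ Z.incl x i ≫ dag (ι i) = 𝟙 _
      rw [Category.assoc, ← Category.assoc (dag (Z.incl x i)), ← Category.assoc, h2, hι.isometry]

include Z in
/-- Objectwise decompositions into objects of pairwise orthogonal full subcategories define a
splitting. The functor `x ↦ (x_i)` is fully faithful, hence normal. -/
theorem nonempty_orthogonalSplitting (hsum : ∀ c : I → C, (∀ i, D i (c i)) →
    ∃ (x : C) (ι : ∀ i, c i ⟶ x), IsOrthogonalDirectSum ι) : Nonempty (OrthogonalSplitting D) :=
  have := Z.essSurj_functor hsum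
  ⟨{functor := Z.functor
    isWStarFunctor := Z.isWStarFunctor_functor
    isEquivalence := {}
    incl := Z.incl
    isOrthogonalDirectSum := Z.isSum
    natural := fun f i => Z.incl_comp f i }⟩

end ObjectwiseSplitting

end Splitting

/-! ### Closure properties of generated subcategories -/

section Closure

variable {C : Type u} [Category.{v} C] [Preadditive C] [Linear ℂ C] [StarCategory C]

theorem eq_zero_of_comp_isometry {w x y : C} {ι : x ⟶ y} (hι : ι ≫ dag ι = 𝟙 x) {f : w ⟶ x}
    (h : f ≫ ι = 0) : f = 0 := by
  rw [← Category.comp_id f, ← hι, ← Category.assoc, h, Limits.zero_comp]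

theorem IsTotalFor.of_isometry {J : Type w} {c : J → C} {x z : C} (h : IsTotalFor c x) {ι : z ⟶ x}
    (hι : ι ≫ dag ι = 𝟙 z) : IsTotalFor c z := by
  intro y f hf
  have h1 : dag ι ≫ f = 0 := h _ fun j g => by
    rw [← Category.assoc]; exact hf j _
  rw [← Category.id_comp f, ← hι, Category.assoc, h1, Limits.comp_zero]

theorem IsTotalFor.of_isSupport {J : Type w} {c : J → C} {x z : C} {e : x ⟶ x} (he : IsSupport c e)
    {ι : z ⟶ x} (hι : ι ≫ dag ι = 𝟙 z) (hιe : ι ≫ e = ι) : IsTotalFor c z := by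
  intro y f hf
  have h1 : e ≫ dag ι ≫ f = 0 := he.comp_eq_zero _ fun j g => by
    rw [← Category.assoc]; exact hf j _
  rw [← Category.id_comp f, ← hι, ← hιe]
  simp only [dag_comp, he.dag_eq, Category.assoc]
  rw [← Category.assoc e e, he.comp_self, h1, Limits.comp_zero]

theorem IsSupport.eq_zero_of_comp_eq_zero {J : Type w} {c : J → C} {x z : C} {e : x ⟶ x}
    (he : IsSupport c e) {ι : z ⟶ x} (hι : ι ≫ dag ι = 𝟙 z) (hιe : ι ≫ e = 0) (j : J)
    (g : c j ⟶ z) : g = 0 :=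
  eq_zero_of_comp_isometry hι (by
    rw [← he.comp_eq j (g ≫ ι), Category.assoc, hιe, Limits.comp_zero])

variable [WStarCategory C]

theorem IsOrthogonalDirectSum.isTotalFor_of_forall {K : Type u'} {J : Type w} {c : J → C}
    {z : K → C} {x : C} {ι : ∀ k, z k ⟶ x} (h : IsOrthogonalDirectSum ι)
    (hz : ∀ k, IsTotalFor c (z k)) : IsTotalFor c x :=
  fun _ _ hf => h.eq_zero fun k => hz k _ fun j g => by
    rw [← Category.assoc]; exact hf j _

theorem IsOrthogonalDirectSum.reindex {K : Type u'} {J : Type w} {c : J → C} {x : C}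
    {ι : ∀ j, c j ⟶ x} (h : IsOrthogonalDirectSum ι) (e : K ≃ J) :
    IsOrthogonalDirectSum fun k => ι (e k) :=
  isOrthogonalDirectSum_of_eq_zero (fun k => h.isometry (e k))
    (fun k l hkl => h.orthogonal _ _ (e.injective.ne hkl))
    fun f hf => h.eq_zero fun j => by
      have := hf (e.symm j)
      rwa [e.apply_symm_apply] at this

theorem isOrthogonalDirectSum_hom_iff {P : ObjectProperty C} {J : Type w}
    {c : J → P.FullSubcategory} {x : P.FullSubcategory} {ι : ∀ j, c j ⟶ x} :
    IsOrthogonalDirectSum (fun j => (ι j).hom) ↔ IsOrthogonalDirectSum ι := by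
  constructor
  · intro h
    refine isOrthogonalDirectSum_of_eq_zero
      (fun j => ObjectProperty.hom_ext _ (h.isometry j))
      (fun j k hjk => ObjectProperty.hom_ext _ (h.orthogonal j k hjk))
      fun f hf => ObjectProperty.hom_ext _ (h.eq_zero fun j => ?_)
    exact congrArg (fun t => t.hom) (hf j)
  · intro h
    refine isOrthogonalDirectSum_of_eq_zero
      (fun j => congrArg (fun t => t.hom) (h.isometry j))
      (fun j k hjk => congrArg (fun t => t.hom) (h.orthogonal j k hjk)) fun f hf => ?_
    have h1 : (ObjectProperty.homMk f : x ⟶ x) = 0 :=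
      h.eq_zero fun j => ObjectProperty.hom_ext _ (hf j)
    exact congrArg (fun t => t.hom) h1

/-- If a set of objects generates a Cauchy complete category, then the morphisms from the
generators to any object are jointly epimorphic: otherwise, the complement of the support of the
object would be nonzero, and receive no nonzero morphisms from the generators. -/
theorem isTotalFor_of_isGenerating (hC : IsCauchyComplete C) {J : Type v} {c : J → C}
    (hc : IsGenerating (Set.range c)) (x : C) : IsTotalFor c x := by
  obtain ⟨e, he⟩ := exists_isSupport hC c x
  have h1 : 𝟙 x - e = 0 := by
    by_contra h0
    obtain ⟨_, ⟨j, rfl⟩, f, hf, hf0⟩ := hc x (𝟙 x - e)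
      (by simp [he.comp_self]) (by rw [dag_sub, dag_id, he.dag_eq]) h0
    apply hf0
    rw [← hf, Preadditive.comp_sub, Category.comp_id, he.comp_eq, sub_self]
  intro y f hf
  rw [← Category.id_comp f, sub_eq_zero.mp h1]
  exact he.comp_eq_zero f hf

end Closure

/-! ### The Gram–Schmidt decomposition -/

section GramSchmidt

variable {C : Type u} [Category.{v} C] [Preadditive C] [Linear ℂ C] [StarCategory C]
  [WStarCategory C]
variable {I : Type v} [LinearOrder I] {c : I → C}

theorem spanLT_iff (hC : IsCauchyComplete C) {i : I} {x : C} :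
    spanLT c i x ↔ IsTotalFor (fun j : Set.Iio i => c j) x := generatedByFamily_iff hC _ x

theorem spanLE_iff (hC : IsCauchyComplete C) {i : I} {x : C} :
    spanLE c i x ↔ IsTotalFor (fun j : Set.Iic i => c j) x := generatedByFamily_iff hC _ x

theorem spanLT.eq_zero (hC : IsCauchyComplete C) {i : I} {x y : C} (hx : spanLT c i x) {f : x ⟶ y}
    (hf : ∀ j < i, ∀ g : c j ⟶ x, g ≫ f = 0) : f = 0 :=
  (spanLT_iff hC).mp hx f fun j => hf j j.2

theorem spanLE.eq_zero (hC : IsCauchyComplete C) {i : I} {x y : C} (hx : spanLE c i x) {f : x ⟶ y}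
    (hf : ∀ j ≤ i, ∀ g : c j ⟶ x, g ≫ f = 0) : f = 0 :=
  (spanLE_iff hC).mp hx f fun j => hf j j.2

theorem spanLT_of_spanLE (hC : IsCauchyComplete C) {i k : I} (hik : i < k) {x : C}
    (hx : spanLE c i x) : spanLT c k x :=
  (spanLT_iff hC).mpr fun _ _ hf => hx.eq_zero hC fun j hj g => hf ⟨j, hj.trans_lt hik⟩ g

theorem spanLE_of_spanLT (hC : IsCauchyComplete C) {i : I} {x : C}
    (hx : spanLT c i x) : spanLE c i x :=
  (spanLE_iff hC).mpr fun _ _ hf => hx.eq_zero hC fun j hj g => hf ⟨j, hj.le⟩ g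

theorem gsPart_iff (hC : IsCauchyComplete C) {i : I} {x : C} :
    gsPart c i x ↔ spanLE c i x ∧ ∀ j < i, ∀ g : c j ⟶ x, g = 0 := by
  refine and_congr_right fun _ => ⟨fun h j hj => ?_, fun h d hd f => ?_⟩
  · exact h _ (generatedByFamily_mem hC.1 (fun j : Set.Iio i => c j) ⟨j, hj⟩)
  · exact hd.eq_zero hC fun j hj g => h j hj _

theorem gsPart.eq_zero_from {i : I} {x d : C} (hx : gsPart c i x) (hd : spanLT c i d) (f : d ⟶ x) :
    f = 0 := hx.2 d hd f

theorem gsPart.eq_zero_to {i : I} {x d : C} (hx : gsPart c i x) (hd : spanLT c i d) (f : x ⟶ d) :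
    f = 0 := by
  rw [← dag_dag f, hx.eq_zero_from hd (dag f), dag_zero]

theorem gsPart_orthogonal (hC : IsCauchyComplete C) {i k : I} (hik : i ≠ k) {x y : C}
    (hx : gsPart c i x) (hy : gsPart c k y) (f : x ⟶ y) : f = 0 := by
  rcases lt_or_gt_of_ne hik with h | h
  · exact hy.eq_zero_from (spanLT_of_spanLE hC h hx.1) f
  · exact hx.eq_zero_to (spanLT_of_spanLE hC h hy.1) f

/-- An object of `C_{≤i}` is the orthogonal direct sum of its support for `C_{<i}` and the
complement of this support. -/
theorem exists_gsPair (hC : IsCauchyComplete C) {i : I} {x : C} (hx : spanLE c i x) :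
    ∃ (z : Bool → C) (ι : ∀ b, z b ⟶ x),
      (∀ b : Bool, (if b then gsPart c i else spanLT c i) (z b)) ∧ IsOrthogonalDirectSum ι := by
  obtain ⟨e, he⟩ := exists_isSupport hC (fun j : Set.Iio i => c j) x
  obtain ⟨z₀, ι₀, h1, h2⟩ := hC.2 x e he.comp_self he.dag_eq
  obtain ⟨z₁, ι₁, h3, h4⟩ := hC.2 x (𝟙 x - e) (by simp [he.comp_self])
    (by rw [dag_sub, dag_id, he.dag_eq])
  have h5 : ι₀ ≫ e = ι₀ := by rw [← h1, ← Category.assoc, h2, Category.id_comp]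
  have h6 : ι₁ ≫ e = 0 := by
    have : ι₁ ≫ (𝟙 x - e) = ι₁ := by rw [← h3, ← Category.assoc, h4, Category.id_comp]
    rwa [Preadditive.comp_sub, Category.comp_id, sub_eq_self] at this
  have hz₀ : spanLT c i z₀ := (spanLT_iff hC).mpr (.of_isSupport he h2 h5)
  have hz₁ : gsPart c i z₁ := (gsPart_iff hC).mpr
    ⟨(spanLE_iff hC).mpr (((spanLE_iff hC).mp hx).of_isometry h4),
      fun j hj g => he.eq_zero_of_comp_eq_zero h4 h6 ⟨j, hj⟩ g⟩
  refine ⟨fun b => cond b z₁ z₀, fun b => match b with | true => ι₁ | false => ι₀, ?_, ?_⟩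
  · rintro (_ | _)
    · exact hz₀
    · exact hz₁
  · refine isOrthogonalDirectSum_of_eq_zero ?_ ?_ fun f hf => ?_
    · rintro (_ | _)
      · exact h2
      · exact h4
    · rintro (_ | _) (_ | _) h
      · exact (h rfl).elim
      · exact hz₁.eq_zero_from hz₀ _
      · exact hz₁.eq_zero_to hz₀ _
      · exact (h rfl).elim
    · have h7 : ι₀ ≫ f = 0 := hf false
      have h8 : ι₁ ≫ f = 0 := hf true
      have h9 : e ≫ f = 0 := by rw [← h1, Category.assoc, h7, Limits.comp_zero]
      have h10 : (𝟙 x - e) ≫ f = 0 := by rw [← h3, Category.assoc, h8, Limits.comp_zero]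
      rw [← Category.id_comp f, ← sub_add_cancel (𝟙 x) e, Preadditive.add_comp, h9, h10, add_zero]

theorem nonempty_orthogonalSplitting_gsPair (hC : IsCauchyComplete C) (i : I) :
    Nonempty (OrthogonalSplitting (gsPair c i)) := by
  have hle : ∀ (b : Bool) (x : C), (if b then gsPart c i else spanLT c i) x → spanLE c i x := by
    rintro (_ | _) x hx
    · exact spanLE_of_spanLT hC hx
    · exact hx.1
  choose z ι h1 h2 using fun x : (spanLE c i).FullSubcategory => exists_gsPair hC x.property
  let Z : ObjectwiseSplitting (gsPair c i) :=
    { obj := fun x b => ⟨z x b, hle b _ (h1 x b)⟩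
      mem := h1
      incl := fun x b => ObjectProperty.homMk (ι x b)
      isSum := fun x => isOrthogonalDirectSum_hom_iff.mp (h2 x)
      orthogonal := by
        rintro (_ | _) (_ | _) hb x y hx hy f
        · exact (hb rfl).elim
        · exact ObjectProperty.hom_ext _ (gsPart.eq_zero_from (i := i) hy hx f.hom)
        · exact ObjectProperty.hom_ext _ (gsPart.eq_zero_to (i := i) hx hy f.hom)
        · exact (hb rfl).elim }
  refine Z.nonempty_orthogonalSplitting fun d _ => ?_
  obtain ⟨x, κ, hκ⟩ := hC.1 (ULift.{v} Bool) fun b => (d b.down).obj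
  have hx : spanLE c i x := (spanLE_iff hC).mpr
    (hκ.isTotalFor_of_forall fun b => (spanLE_iff hC).mp (d b.down).property)
  exact ⟨⟨x, hx⟩, fun b => ObjectProperty.homMk (κ ⟨b⟩),
    isOrthogonalDirectSum_hom_iff.mp (hκ.reindex Equiv.ulift.symm)⟩

/-- Every object is the orthogonal direct sum of the differences of its supports for `C_{≤i}` and
for `C_{<i}`. That these differences exhaust the object is shown by transfinite induction. -/
theorem exists_gsPart [WellFoundedLT I] (hC : IsCauchyComplete C)
    (hc : IsGenerating (Set.range c)) (x : C) :
    ∃ (z : I → C) (ι : ∀ i, z i ⟶ x), (∀ i, gsPart c i (z i)) ∧ IsOrthogonalDirectSum ι := by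
  choose e he using fun i : I => exists_isSupport hC (fun j : Set.Iio i => c j) x
  choose e' he' using fun i : I => exists_isSupport hC (fun j : Set.Iic i => c j) x
  have h1 : ∀ i, e i ≫ e' i = e i := fun i => by
    have : e i ≫ (𝟙 x - e' i) = 0 := (he i).comp_eq_zero _ fun j g => by
      rw [Preadditive.comp_sub, Category.comp_id, (he' i).comp_eq ⟨j.1, le_of_lt j.2⟩ g, sub_self]
    rw [Preadditive.comp_sub, Category.comp_id, sub_eq_zero] at this
    exact this.symm
  have h2 : ∀ i, e' i ≫ e i = e i := fun i => by
    have := congrArg dag (h1 i)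
    rwa [dag_comp, (he i).dag_eq, (he' i).dag_eq] at this
  have h3 := fun i => hC.2 x (e' i - e i)
    (by simp [(he i).comp_self, (he' i).comp_self, h1, h2])
    (by rw [dag_sub, (he i).dag_eq, (he' i).dag_eq])
  choose z ι h4 h5 using h3
  have h6 : ∀ i, ι i ≫ (e' i - e i) = ι i := fun i => by
    rw [← h4, ← Category.assoc, h5, Category.id_comp]
  have h7 : ∀ i, ι i ≫ e' i = ι i := fun i => by
    conv_rhs => rw [← h6 i]
    rw [← h6 i, Category.assoc, Category.assoc]
    simp [(he i).comp_self, (he' i).comp_self, h1, h2]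
  have h8 : ∀ i, ι i ≫ e i = 0 := fun i => by
    rw [← h6 i, Category.assoc]
    simp [(he i).comp_self, h2]
  have hz : ∀ i, gsPart c i (z i) := fun i => (gsPart_iff hC).mpr
    ⟨(spanLE_iff hC).mpr (.of_isSupport (he' i) (h5 i) (h7 i)),
      fun j hj g => (he i).eq_zero_of_comp_eq_zero (h5 i) (h8 i) ⟨j, hj⟩ g⟩
  refine ⟨z, ι, hz, isOrthogonalDirectSum_of_eq_zero h5
    (fun i k hik => gsPart_orthogonal hC hik (hz i) (hz k) _) fun f hf => ?_⟩
  have h9 : ∀ i, e' i ≫ f = 0 := by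
    intro i
    induction i using WellFoundedLT.induction with
    | ind i ih =>
      have h10 : e i ≫ f = 0 := (he i).comp_eq_zero _ fun ⟨j, hj⟩ g => by
        change c j ⟶ x at g
        rw [← (he' j).comp_eq ⟨j, le_refl j⟩ g, Category.assoc, ih j hj, Limits.comp_zero]
      rw [← sub_add_cancel (e' i) (e i), Preadditive.add_comp, h10, ← h4, Category.assoc, hf]
      simp
  exact isTotalFor_of_isGenerating hC hc x f fun i g => by
    rw [← (he' i).comp_eq ⟨i, le_refl i⟩ g, Category.assoc, h9, Limits.comp_zero]

theorem nonempty_orthogonalSplitting_gsPart [WellFoundedLT I] (hC : IsCauchyComplete C)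
    (hc : IsGenerating (Set.range c)) : Nonempty (OrthogonalSplitting (gsPart c)) := by
  choose z ι h1 h2 using exists_gsPart hC hc
  let Z : ObjectwiseSplitting (gsPart c) :=
    { obj := z
      mem := h1
      incl := ι
      isSum := h2
      orthogonal := fun i j hij a b ha hb f => gsPart_orthogonal hC hij ha hb f }
  exact Z.nonempty_orthogonalSplitting fun d _ => hC.1 I d

/-! ### The orthogonalised generators -/

theorem gsIncl_isOrthogonalDirectSum {i : I} (S : OrthogonalSplitting (gsPair c i))
    (x : (spanLE c i).FullSubcategory) :
    IsOrthogonalDirectSum fun b => (S.incl x b).hom :=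
  isOrthogonalDirectSum_hom_iff.mpr (S.isOrthogonalDirectSum x)

theorem spanLT_proj_false {i : I} (S : OrthogonalSplitting (gsPair c i))
    (x : (spanLE c i).FullSubcategory) : spanLT c i (S.proj false x).obj.obj :=
  (S.proj false x).property

/-- The generator `c i` is the orthogonal direct sum of `Q_i(c i)` and an object of `C_{<i}`, so
that a morphism out of it may be tested on the `c j` with `j < i` and on `Q_i(c i)`. -/
theorem eq_zero_of_gsProj (hC : IsCauchyComplete C) {i : I} (S : OrthogonalSplitting (gsPair c i))
    {y : C} {f : c i ⟶ y} (h1 : ∀ j < i, ∀ g : c j ⟶ y, (∃ h : c j ⟶ c i, g = h ≫ f) → g = 0)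
    (h2 : ∀ g : (gsProj S (genObj c hC.1 i)).obj ⟶ c i, g ≫ f = 0) : f = 0 := by
  refine (gsIncl_isOrthogonalDirectSum S (genObj c hC.1 i)).eq_zero ?_
  rintro (_ | _)
  · exact (spanLT_proj_false S (genObj c hC.1 i)).eq_zero hC fun j hj g =>
      h1 j hj _ ⟨g ≫ (S.incl (genObj c hC.1 i) false).hom, (Category.assoc _ _ _).symm⟩
  · exact h2 _

theorem isGenerating_gsProj (hC : IsCauchyComplete C) {i : I}
    (S : OrthogonalSplitting (gsPair c i)) : IsGenerating {gsProj S (genObj c hC.1 i)} := by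
  intro x p hpp _ hp0
  by_contra hcon
  have hq : ∀ f : gsProj S (genObj c hC.1 i) ⟶ x, f ≫ p = 0 := fun f => by
    by_contra hf
    exact hcon ⟨_, rfl, f ≫ p, by rw [Category.assoc, hpp], hf⟩
  obtain ⟨hx1, hx2⟩ := (gsPart_iff hC).mp x.property
  refine hp0 (ObjectProperty.hom_ext _ (hx1.eq_zero hC fun j hj g => ?_))
  rcases hj.lt_or_eq with hj | rfl
  · rw [hx2 j hj g, Limits.zero_comp]
  · refine eq_zero_of_gsProj hC S (fun k hk h _ => hx2 k hk h) fun h => ?_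
    have := congrArg (fun t => t.hom) (hq (ObjectProperty.homMk (h ≫ g)))
    rw [← Category.assoc]
    exact this

theorem isGenerating_range_gsProj [WellFoundedLT I] (hC : IsCauchyComplete C)
    (hc : IsGenerating (Set.range c)) (S : ∀ i, OrthogonalSplitting (gsPair c i)) :
    IsGenerating (Set.range fun i => (gsProj (S i) (genObj c hC.1 i)).obj) := by
  intro x p hpp _ hp0
  by_contra hcon
  have hq : ∀ i, ∀ f : (gsProj (S i) (genObj c hC.1 i)).obj ⟶ x, f ≫ p = 0 := fun i f => by
    by_contra hf
    exact hcon ⟨_, ⟨i, rfl⟩, f ≫ p, by rw [Category.assoc, hpp], hf⟩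
  have h : ∀ i, ∀ g : c i ⟶ x, g ≫ p = 0 := by
    intro i
    induction i using WellFoundedLT.induction with
    | ind i ih =>
      intro g
      refine eq_zero_of_gsProj hC (S i) ?_ fun h => ?_
      · rintro j hj _ ⟨h, rfl⟩
        rw [← Category.assoc, ih j hj]
      · rw [← Category.assoc, hq]
  exact hp0 (isTotalFor_of_isGenerating hC hc x p h)

/-- The summands of `x ∈ C_{≤i}` in `C_i` for the splittings of `C_{≤i}` and of `C` are the same
subobject of `x`. -/
theorem exists_unitary_gsProj (hC : IsCauchyComplete C) {i : I}
    (S : OrthogonalSplitting (gsPair c i)) (T : OrthogonalSplitting (gsPart c))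
    (x : (spanLE c i).FullSubcategory) :
    ∃ t : (T.proj i x.obj).obj ⟶ (gsProj S x).obj,
      t ≫ dag t = 𝟙 _ ∧ dag t ≫ t = 𝟙 _ ∧ t ≫ (S.incl x true).hom = T.incl x.obj i := by
  have hS := gsIncl_isOrthogonalDirectSum S x
  have hT := T.isOrthogonalDirectSum x.obj
  set σ : (gsProj S x).obj ⟶ x.obj := (S.incl x true).hom
  set τ : (T.proj i x.obj).obj ⟶ x.obj := T.incl x.obj i
  have hσσ : σ ≫ dag σ = 𝟙 _ := hS.isometry true
  have hττ : τ ≫ dag τ = 𝟙 _ := hT.isometry i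
  have h1 : τ ≫ dag σ ≫ σ = τ := hS.comp_dag_comp true fun b hb => by
    obtain rfl : b = false := by simpa using hb
    exact gsPart.eq_zero_to (T.proj i x.obj).property (spanLT_proj_false S x) _
  have h2 : σ ≫ dag τ ≫ τ = σ := hT.comp_dag_comp i fun k hk =>
    gsPart_orthogonal hC hk.symm (gsProj S x).property (T.proj k x.obj).property _
  refine ⟨τ ≫ dag σ, ?_, ?_, ?_⟩
  · rw [dag_comp, dag_dag, Category.assoc, ← Category.assoc (dag σ), ← Category.assoc, h1, hττ]
  · rw [dag_comp, dag_dag, Category.assoc, ← Category.assoc (dag τ), ← Category.assoc, h2, hσσ]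
  · rw [Category.assoc, h1]

end GramSchmidt

end

end WStarCat

theorem mainTheorem7 {C : Type u} [Category.{v} C] [Preadditive C] [Linear ℂ C]
    [StarCategory C] [WStarCategory C] (hC : IsCauchyComplete C)
    {I : Type v} [LinearOrder I] [WellFoundedLT I] (c : I → C)
    (hc : IsGenerating (Set.range c)) :
    -- `C_{≤i} = C_{<i} ⊞ C_i`, with projections `P_i` and `Q_i`
    (∀ i, Nonempty (OrthogonalSplitting (gsPair c i))) ∧
    -- `C = ⊞ C_i`
    Nonempty (OrthogonalSplitting (gsPart c)) ∧
    -- whatever the choice of the projections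
    ∀ S : ∀ i, OrthogonalSplitting (gsPair c i),
      -- `Q_i(c_i)` generates `C_i`
      (∀ i, IsGenerating {gsProj (S i) (genObj c hC.1 i)}) ∧
      -- the `Q_i(c_i)` are an orthogonal set of generators of `C`
      IsOrthogonalFamily (fun i => (gsProj (S i) (genObj c hC.1 i)).obj) ∧
      IsGenerating (Set.range fun i => (gsProj (S i) (genObj c hC.1 i)).obj) ∧
      -- the projections `C ↠ C_i` of `C = ⊞ C_i` restrict to the `Q_i`
      ∀ (T : OrthogonalSplitting (gsPart c)) (i : I) (x : (spanLE c i).FullSubcategory),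
        ∃ t : (T.proj i x.obj).obj ⟶ (gsProj (S i) x).obj,
          t ≫ dag t = 𝟙 _ ∧ dag t ≫ t = 𝟙 _ ∧
          t ≫ ((S i).incl x true).hom = T.incl x.obj i :=
  ⟨nonempty_orthogonalSplitting_gsPair hC, nonempty_orthogonalSplitting_gsPart hC hc, fun S =>
    ⟨fun i => isGenerating_gsProj hC (S i),
      fun i j hij f => gsPart_orthogonal hC hij (gsProj (S i) (genObj c hC.1 i)).property
        (gsProj (S j) (genObj c hC.1 j)).property f,
      isGenerating_range_gsProj hC hc S, fun T i x => exists_unitary_gsProj hC (S i) T x⟩⟩
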